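/- Let $n \ge 1$, $[n]=\{1,\dots,n\}$, let $\mathcal P_n$ be the family of all subsets of $[n]$, let $S^{n-1}$ be the Euclidean unit sphere of $\mathbb R^n$, and let "measure" mean finite signed Borel measure on $\mathbb R^n$. For a Borel set $A$ let $\mathcal M(A)$ be the space of measures concentrated on $A$. We use the following notation. - For measures $\mu,\nu$, the multiplicative convolution is $(\mu\circledast\nu)(A)=\iint \mathbf 1_A(xy)\,\nu(dy)\,\mu(dx)$ with the componentwise product $xy$. For a measure $\mu$ with $\int\|x\|\,|\mu|(dx)<\infty$, the radial projection $P_S(\mu)\in\mathcal M(S^{n-1})$ is $P_S(\mu)(B)=\int_{\mathbb R^n\setminus\{0\}}\|x\|\,\mathbf 1_B(x/\|x\|)\,\mu(dx)$. Set $\mu\circledast_S\nu=P_S(\mu\circledast\nu)$. - For $E\subset[n]$: $P_E$ is the orthogonal projection onto $\operatorname{lin}\{e_i:i\in E\}$, $P_E(\mu)$ is the image measure, and $P^S_E(\mu)=P_S(P_E(\mu))$, with $P^S_i=P^S_{\{i\}}$; $A_E=\{x\in\mathbb R^n: x_i\ne0\Leftrightarrow i\in E\}$, $B_E=A_E\cap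 S^{n-1}$, and $R_E(\mu)=\mu_E=\mu(\,\cdot\,\cap A_E)$. A measure $\mu$ is of order $[n]$ if $|\mu|(A_{[n]})>0$ and $|\mu|(A_F)=0$ for all $F\ne[n]$. - $T_F$ is the reflection that changes the sign of the coordinates in $F\subset[n]$. For $\mathcal F_e,\mathcal F_o\subset\mathcal P_n$, $\mathcal M(A;\mathcal F_e,\mathcal F_o)$ is the set of $\mu\in\mathcal M(A)$ with $T_F(\mu)=\mu$ for all $F\in\mathcal F_e$ and $T_F(\mu)=-\mu$ for all $F\in\mathcal F_o$. $M_{\rm sym}=\frac12(T_\emptyset+T_{[n]})$. - $\mathcal J(E;\mathcal F_e,\mathcal F_o)$ is the family of $J\subset E$ such that $|J\cap F|$ is even for all $F\in\mathcal F_e$ and odd for all $F\in\mathcal F_o$; $\mathcal J(\mathcal F_e,\mathcal F_o)=\mathcal J([n];\mathcal F_e,\mathcal F_o)$. - For $J\subset E\subset[n]$, $\delta_{E,J}=2^{-|E|}\sum_{s}\big(\prod_{j\in J}s_j\big)\delta_s$, where $s$ runs over the vectors with $s_j\in\{-1,1\}$ for $j\in E$ and $s_j=0$ for $j\notin E$;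 $\delta_J=\delta_{[n],J}$. - $\nu\in\mathcal M(S^{n-1})$ is spherically universal on $\mathcal A\subset\mathcal M(S^{n-1})$ if, for every $\mu\in\mathcal A$, $\nu\circledast_S\mu=0$ implies $\mu=0$. Let $\mathcal F_e,\mathcal F_o\subset\mathcal P_n$ and $\nu\in\mathcal M(S^{n-1})$. Then: (i) $\nu$ is spherically universal on $\mathcal M(B_{[n]};\mathcal F_e,\mathcal F_o)$ if and only if $\delta_J\circledast_S\nu_{[n]}\ne0$ for all $J\in\mathcal J(\mathcal F_e,\mathcal F_o)$. (ii) $\nu$ is spherically universal on $\mathcal M(S^{n-1};\mathcal F_e,\mathcal F_o)$ if and only if $\delta_J\circledast_S R_EP^S_E(\nu)\ne0$ for all $E\subset[n]$ with $E\neq\emptyset$ and all $J\in\mathcal J(E;\mathcal F_e,\mathcal F_o)$. (iii) If $\nu$ is of order $[n]$, then $\nu$ is spherically universal on $\mathcal M(S^{n-1};\mathcal F_e,\mathcal F_o)$ if and only if $\delta_{E,J}\circledast_S\nu\ne0$ for all $E\subset[n]$ with $E\ne\emptyset$ and all $J\in\mathcal J(E;\mathcal F_e,\mathcal F_o)$.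 (iv) If $\nu$ is of order $[n]$, then $\nu$ is spherically universal on $\mathcal M(S^{n-1};\mathcal F_e,\mathcal F_o)$ if and only if both $\delta_{J,J}\circledast_S\nu\ne0$ for all $J\in\mathcal J(\mathcal F_e,\mathcal F_o)$ with $J\neq\emptyset$ and, provided $\mathcal F_o=\emptyset$, also $M_{\rm sym}P^S_i(\nu)\ne0$ for all $i\in[n]$. -/

import Mathlib

open MeasureTheory

noncomputable section

namespace SphericalConvolution

/-- Euclidean space `ℝⁿ`, with the Euclidean norm and the Borel `σ`-field. -/
abbrev Euc (n : ℕ) : Type := EuclideanSpace ℝ (Fin n)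

/-- Finite signed Borel measures on `ℝⁿ`. -/
abbrev SMeas (n : ℕ) : Type := SignedMeasure (Euc n)

/-- The componentwise product of two vectors. -/
def hadamard {n : ℕ} (x y : Euc n) : Euc n := WithLp.toLp 2 fun i => x i * y i

/-- The orthogonal projection of `ℝⁿ` on the coordinate subspace indexed by `E`. -/
def coordProj {n : ℕ} (E : Finset (Fin n)) (x : Euc n) : Euc n :=
  WithLp.toLp 2 fun i => if i ∈ E then x i else 0

/-- The multiple reflection `T_E` of `ℝⁿ`: it changes the sign of the coordinates in `E`. -/
def reflect {n : ℕ} (E : Finset (Fin n)) (x : Euc n) : Euc n :=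
  WithLp.toLp 2 fun i => if i ∈ E then -x i else x i

/-- The unit sphere of `ℝⁿ`. -/
def unitSphere (n : ℕ) : Set (Euc n) := Metric.sphere 0 1

/-- `A_E`: the vectors whose non-zero coordinates are exactly those in `E`. -/
def cell {n : ℕ} (E : Finset (Fin n)) : Set (Euc n) := {x | ∀ i, x i ≠ 0 ↔ i ∈ E}

/-- `B_E = A_E ∩ S^{n-1}`. -/
def sphereCell {n : ℕ} (E : Finset (Fin n)) : Set (Euc n) := cell E ∩ unitSphere n

theorem measurable_hadamard {n : ℕ} :
    Measurable fun p : Euc n × Euc n => hadamard p.1 p.2 := by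
  unfold hadamard
  fun_prop

theorem measurable_coordProj {n : ℕ} (E : Finset (Fin n)) : Measurable (coordProj E) := by
  apply (WithLp.measurable_toLp 2 _).comp
  refine measurable_pi_lambda _ fun i => ?_
  by_cases h : i ∈ E <;> simp only [h, if_true, if_false] <;> fun_prop

theorem measurable_reflect {n : ℕ} (E : Finset (Fin n)) : Measurable (reflect E) := by
  apply (WithLp.measurable_toLp 2 _).comp
  refine measurable_pi_lambda _ fun i => ?_
  by_cases h : i ∈ E <;> simp only [h, if_true, if_false] <;> fun_prop

theorem measurable_normalize {n : ℕ} : Measurable fun x : Euc n => ‖x‖⁻¹ • x := by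
  fun_prop

theorem measurableSet_cell {n : ℕ} (E : Finset (Fin n)) : MeasurableSet (cell E) := by
  have : cell E = ⋂ i, {x : Euc n | x i ≠ 0 ↔ i ∈ E} := by
    ext x; simp [cell]
  rw [this]
  refine MeasurableSet.iInter fun i => ?_
  have h0 : MeasurableSet {x : Euc n | x i = 0} :=
    measurableSet_eq_fun (by fun_prop) measurable_const
  by_cases h : i ∈ E
  · simp only [h, iff_true]
    exact h0.compl
  · simp only [h, iff_false, not_not]
    exact h0

instance instIsFiniteMeasureVariation {α : Type*} [MeasurableSpace α] (μ : SignedMeasure α) :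
    IsFiniteMeasure μ.variation := by
  rw [← SignedMeasure.totalVariation_eq_variation]
  unfold SignedMeasure.totalVariation
  infer_instance

/-- `μ` vanishes on all Borel sets disjoint from `A`. The space `ℳ(A)` of measures on `A` is
identified with the space of those measures on `ℝⁿ` that are concentrated on `A`. -/
def IsConcentratedOn {n : ℕ} (μ : SMeas n) (A : Set (Euc n)) : Prop :=
  ∀ B : Set (Euc n), MeasurableSet B → B ⊆ Aᶜ → μ B = 0

/-- The multiplicative convolution `μ ⊛ ν`: the image of the product measure under the
componentwise product of vectors. -/
def mconv {n : ℕ} (μ ν : SMeas n) : SMeas n :=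
  (μ.prod ν (ContinuousLinearMap.lsmul ℝ ℝ)).map fun p => hadamard p.1 p.2

/-- The multiplicative convolution as an iterated integral:
`(μ ⊛ ν)(A) = ∫ μ(dx) ν {y | x y ∈ A}`. -/
theorem mconv_apply {n : ℕ} (μ ν : SMeas n) {A : Set (Euc n)} (hA : MeasurableSet A) :
    mconv μ ν A = ∫ᵛ x, ν {y | hadamard x y ∈ A} ∂<•μ := by
  rw [mconv, VectorMeasure.map_apply _ measurable_hadamard hA,
    VectorMeasure.prod_apply_eq_integral (measurable_hadamard hA)]
  rfl

/-- The radial projection `P_S(μ)` of an integrable measure `μ` on the unit sphere: the image of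
the measure `‖x‖ μ(dx)`, which does not charge the origin, under `x ↦ x / ‖x‖`. -/
def sphProj {n : ℕ} (μ : SMeas n) : SMeas n :=
  (μ.withDensity (fun x => ‖x‖) (ContinuousLinearMap.lsmul ℝ ℝ)).map fun x => ‖x‖⁻¹ • x

/-- The radial projection of an integrable measure as an integral. -/
theorem sphProj_apply {n : ℕ} (μ : SMeas n) (hμ : Integrable (fun x : Euc n => ‖x‖) μ.variation)
    {B : Set (Euc n)} (hB : MeasurableSet B) :
    sphProj μ B = ∫ᵛ x in {x | ‖x‖⁻¹ • x ∈ B}, ‖x‖ ∂•μ := by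
  rw [sphProj, VectorMeasure.map_apply _ measurable_normalize hB,
    VectorMeasure.withDensity_apply hμ]
  rfl

/-- The product `μ ⊛_S ν = P_S(μ ⊛ ν)` of integrable measures. -/
def sconv {n : ℕ} (μ ν : SMeas n) : SMeas n := sphProj (mconv μ ν)

/-- `P^S_E = P_S ∘ P_E`: the marginal on the coordinate subspace indexed by `E`, followed by the
radial projection. -/
def sphCoordProj {n : ℕ} (E : Finset (Fin n)) (μ : SMeas n) : SMeas n :=
  sphProj (μ.map (coordProj E))

/-- `R_E(μ) = μ_E`: the restriction `A ↦ μ (A ∩ A_E)` of `μ` to the cell `A_E`. -/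
def component {n : ℕ} (E : Finset (Fin n)) (μ : SMeas n) : SMeas n := μ.restrict (cell E)

/-- `μ` is of order `E`: `|μ|(A_E) > 0` and `|μ|(A_F) = 0` for all `F ≠ E`. -/
def IsOfOrder {n : ℕ} (μ : SMeas n) (E : Finset (Fin n)) : Prop :=
  0 < μ.variation (cell E) ∧ ∀ F : Finset (Fin n), F ≠ E → μ.variation (cell F) = 0

/-- `μ` is even under `T_F`. -/
def IsEvenUnder {n : ℕ} (μ : SMeas n) (F : Finset (Fin n)) : Prop := μ.map (reflect F) = μ

/-- `μ` is odd under `T_F`. -/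
def IsOddUnder {n : ℕ} (μ : SMeas n) (F : Finset (Fin n)) : Prop := μ.map (reflect F) = -μ

/-- `ℳ(A; ℱ_e, ℱ_o)`: the measures on `A` that are even under `T_F` for all `F ∈ ℱ_e` and odd
under `T_F` for all `F ∈ ℱ_o`. -/
def symMeasures {n : ℕ} (A : Set (Euc n)) (Fe Fo : Set (Finset (Fin n))) : Set (SMeas n) :=
  {μ | IsConcentratedOn μ A ∧ (∀ F ∈ Fe, IsEvenUnder μ F) ∧ ∀ F ∈ Fo, IsOddUnder μ F}

/-- The origin-symmetrisation `M_sym = (T_∅ + T_[n]) / 2`. -/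
def symmetrise {n : ℕ} (μ : SMeas n) : SMeas n :=
  (1 / 2 : ℝ) • (μ.map (reflect ∅) + μ.map (reflect Finset.univ))

/-- `σ_J(x)`: the product of the signs of the coordinates `x_j`, `j ∈ J`. -/
def signProd {n : ℕ} (J : Finset (Fin n)) (x : Euc n) : ℝ := ∏ j ∈ J, Real.sign (x j)

/-- The sign vectors `s` with `s_j ∈ {-1, 1}` for `j ∈ E` and `s_j = 0` for `j ∉ E`. -/
def signVectors {n : ℕ} (E : Finset (Fin n)) : Finset (Fin n → ℝ) :=
  Fintype.piFinset fun j => if j ∈ E then {-1, 1} else {0}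

/-- The measure `δ_{E,J} = 2^{-|E|} ∑ σ_J(s) δ_s`, the sum being over the sign vectors `s` of
`E`. -/
def deltaMeas {n : ℕ} (E J : Finset (Fin n)) : SMeas n :=
  ((2 : ℝ) ^ E.card)⁻¹ • ∑ s ∈ signVectors E,
    signProd J (WithLp.toLp 2 s) • VectorMeasure.dirac (WithLp.toLp 2 s : Euc n) (1 : ℝ)

/-- `𝒥(E; ℱ_e, ℱ_o)`: the sets `J ⊆ E` such that `|J ∩ F|` is even for all `F ∈ ℱ_e` and odd for
all `F ∈ ℱ_o`. -/
def indexFamily {n : ℕ} (E : Finset (Fin n)) (Fe Fo : Set (Finset (Fin n))) :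
    Set (Finset (Fin n)) :=
  {J | J ⊆ E ∧ (∀ F ∈ Fe, Even (J ∩ F).card) ∧ ∀ F ∈ Fo, Odd (J ∩ F).card}

/-- `ν` is spherically universal on `𝒜`: for `μ ∈ 𝒜`, `ν ⊛_S μ = 0` implies `μ = 0`. -/
def IsSphericallyUniversal {n : ℕ} (ν : SMeas n) (𝒜 : Set (SMeas n)) : Prop :=
  ∀ μ ∈ 𝒜, sconv ν μ = 0 → μ = 0

end SphericalConvolution

end

open SphericalConvolution

/-! The proof rests on a Mellin-type transform that turns `sconv` into multiplication. For `J ⊆ E`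
and exponents `a` that are positive on `E`, zero elsewhere and of sum one, integrate `σ_J(x) ∏
|x_i|^{a_i}`. This function is multiplicative for the componentwise product and positively
homogeneous of degree one, so radial projection does not change its integral; hence
`transform_sconv`.

Two facts make the transform decisive. Measures on the sphere are determined by it
(`eq_zero_of_transform_eq_zero`): cell by cell, the transforms contain the exponential moments of
the logarithmic coordinates on each orthant. Moreover, it is real analytic along lines of weights,
so if a product of two transforms vanishes for all weights of `E`, one factor does
(`transform_eq_zero_or_of_mul_eq_zero`).

Suppose `ν ⊛_S μ = 0`. If `J` violates a parity condition, the symmetry of `μ` kills its transform.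
Otherwise it vanishes as soon as the transform of `ν` for `(E, J)` is not identically zero, which is
`HasNonzeroTransform`. Conversely, if the transform of `ν` for `(E, J)` is identically zero,
`cellWitness E J` is a nonzero symmetric measure annihilated by `ν`, since it has no other nonzero
transforms.

So (i) and (ii) amount to `HasNonzeroTransform` for the relevant pairs, and
`sconv_deltaMeas_ne_zero_iff` rewrites this through the measures `δ`. If `ν` is of order `[n]`, it
lives where no coordinate vanishes; projection becomes superfluous, which gives (iii), and
transforms are continuous up to the boundary of the weight simplex, so only the minimal `E` for each
`J` matter, which gives (iv). -/

namespace SphericalConvolution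

open Filter Topology

/-! ### Integration against signed measures: densities, products, exponential moments. -/

section SignedIntegral

variable {α β : Type*} {mα : MeasurableSpace α} {mβ : MeasurableSpace β}

theorem lsmul_flip_real :
    (ContinuousLinearMap.lsmul ℝ ℝ : ℝ →L[ℝ] ℝ →L[ℝ] ℝ).flip = ContinuousLinearMap.lsmul ℝ ℝ := by
  ext; simp

theorem posPart_le_variation (μ : SignedMeasure α) :
    μ.toJordanDecomposition.posPart ≤ μ.variation := by
  rw [← SignedMeasure.totalVariation_eq_variation, SignedMeasure.totalVariation]
  exact Measure.le_add_right le_rfl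

theorem negPart_le_variation (μ : SignedMeasure α) :
    μ.toJordanDecomposition.negPart ≤ μ.variation := by
  rw [← SignedMeasure.totalVariation_eq_variation, SignedMeasure.totalVariation]
  exact Measure.le_add_left le_rfl

theorem eq_posPart_sub_negPart (μ : SignedMeasure α) :
    μ = μ.toJordanDecomposition.posPart.toSignedMeasure -
      μ.toJordanDecomposition.negPart.toSignedMeasure :=
  (SignedMeasure.toSignedMeasure_toJordanDecomposition μ).symm

theorem integral_toSignedMeasure' (μ : Measure α) [IsFiniteMeasure μ] (f : α → ℝ) :
    ∫ᵛ x, f x ∂•μ.toSignedMeasure = ∫ x, f x ∂μ := by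
  rw [← lsmul_flip_real, VectorMeasure.integral_toSignedMeasure]

theorem integral_eq_posPart_sub_negPart (μ : SignedMeasure α) {f : α → ℝ}
    (hf : Integrable f μ.variation) :
    ∫ᵛ x, f x ∂•μ = ∫ x, f x ∂μ.toJordanDecomposition.posPart -
      ∫ x, f x ∂μ.toJordanDecomposition.negPart := by
  conv_lhs => rw [eq_posPart_sub_negPart μ]
  rw [VectorMeasure.integral_sub_vectorMeasure, integral_toSignedMeasure',
    integral_toSignedMeasure']
  · simpa [VectorMeasure.Integrable] using hf.mono_measure (posPart_le_variation μ)
  · simpa [VectorMeasure.Integrable] using hf.mono_measure (negPart_le_variation μ)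

theorem variation_withDensity_real (μ : SignedMeasure α) {g : α → ℝ}
    (hg : Integrable g μ.variation) :
    (μ.withDensity g (ContinuousLinearMap.lsmul ℝ ℝ)).variation =
      μ.variation.withDensity fun x => ‖g x‖ₑ := by
  rw [VectorMeasure.variation_withDensity hg (by simp),
    VectorMeasure.variation_transpose_lsmul]

/-- The variation of `g μ` has density `|g|`, and `h |g|` and `h g` differ only by the bounded
factor `g / |g|`. Where `g = 0` that factor is `0 / 0 = 0`, which is harmless. -/
theorem integrable_withDensity_real_iff (μ : SignedMeasure α) {g h : α → ℝ}
    (hgm : Measurable g) (hg : Integrable g μ.variation) :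
    Integrable h (μ.withDensity g (ContinuousLinearMap.lsmul ℝ ℝ)).variation ↔
      Integrable (fun x => h x * g x) μ.variation := by
  rw [variation_withDensity_real μ hg]
  have : (fun x => ‖g x‖ₑ) = fun x => ((‖g x‖₊ : NNReal) : ENNReal) := rfl
  rw [this, integrable_withDensity_iff_integrable_smul₀ hgm.nnnorm.aemeasurable]
  have key {u v : α → ℝ} (hu : Integrable u μ.variation) (h : ∀ x, g x / |g x| * u x = v x) :
      Integrable v μ.variation := by
    refine (hu.bdd_mul (f := fun x => g x / |g x|) (c := 1) ?_ ?_).congr (.of_forall h)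
    · exact (hgm.div hgm.abs).aestronglyMeasurable
    · filter_upwards with x
      rw [norm_div, Real.norm_eq_abs, Real.norm_eq_abs, abs_abs]
      exact div_self_le_one _
  refine ⟨fun H => key H fun x => ?_, fun H => key H fun x => ?_⟩ <;>
  · simp only [NNReal.smul_def, coe_nnnorm, smul_eq_mul, Real.norm_eq_abs]
    rcases lt_trichotomy (g x) 0 with hx | hx | hx
    · rw [abs_of_neg hx]; field_simp
    · simp [hx]
    · rw [abs_of_pos hx]; field_simp

theorem integral_withDensity_real (μ : SignedMeasure α) {g : α → ℝ}
    (hgm : Measurable g) (hg : Integrable g μ.variation) {h : α → ℝ}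
    (hh : Integrable h (μ.withDensity g (ContinuousLinearMap.lsmul ℝ ℝ)).variation) :
    ∫ᵛ x, h x ∂•(μ.withDensity g (ContinuousLinearMap.lsmul ℝ ℝ)) =
      ∫ᵛ x, h x * g x ∂•μ := by
  have hi {u : α → ℝ} :
      Integrable u (μ.withDensity g (ContinuousLinearMap.lsmul ℝ ℝ)).variation →
      Integrable (fun x => u x * g x) μ.variation :=
    (integrable_withDensity_real_iff μ hgm hg).1
  have hae {u v : α → ℝ}
      (huv : u =ᵐ[(μ.withDensity g (ContinuousLinearMap.lsmul ℝ ℝ)).variation] v) :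
      (fun x => u x * g x) =ᵐ[μ.variation] fun x => v x * g x := by
    rw [variation_withDensity_real μ hg, Filter.EventuallyEq,
      ae_withDensity_iff (by fun_prop)] at huv
    filter_upwards [huv] with x hx
    by_cases h0 : g x = 0
    · simp [h0]
    · rw [hx (by simpa using h0)]
  refine Integrable.induction (P := fun h =>
    ∫ᵛ x, h x ∂•(μ.withDensity g (ContinuousLinearMap.lsmul ℝ ℝ)) =
      ∫ᵛ x, h x * g x ∂•μ) ?_ ?_ ?_ ?_ hh
  · intro c s hs _
    rw [VectorMeasure.integral_indicator hs, VectorMeasure.setIntegral_const,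
      VectorMeasure.withDensity_apply hg]
    have : (fun x => s.indicator (fun _ => c) x * g x) = s.indicator fun x => c • g x := by
      ext x; by_cases hx : x ∈ s <;> simp [hx]
    rw [this, VectorMeasure.integral_indicator hs, VectorMeasure.integral_fun_smul]
    simp
  · intro u v _ hu hv h1 h2
    rw [VectorMeasure.integral_add hu hv, h1, h2, ← VectorMeasure.integral_fun_add (hi hu) (hi hv)]
    simp [add_mul]
  -- The map `u ↦ ∫ u g dμ` is 1-Lipschitz on `L¹(|g| |μ|)`, so the identity passes to limits.
  · refine isClosed_eq VectorMeasure.continuous_integral ?_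
    refine (LipschitzWith.of_dist_le_mul (K := 1) fun u v => ?_).continuous
    have hu := hi (L1.integrable_coeFn u)
    have hv := hi (L1.integrable_coeFn v)
    rw [Real.dist_eq, ← VectorMeasure.integral_fun_sub hu hv, ← Real.norm_eq_abs]
    refine VectorMeasure.norm_integral_le_integral_norm.trans ?_
    have h1 : ∫ x, ‖u x * g x - v x * g x‖ ∂μ.variation = dist u v := by
      rw [dist_eq_norm, L1.norm_eq_integral_norm]
      have hF (F : α → ℝ) :
          ∫ x, F x ∂(μ.withDensity g (ContinuousLinearMap.lsmul ℝ ℝ)).variation =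
            ∫ x, ‖g x‖₊ • F x ∂μ.variation := by
        rw [variation_withDensity_real μ hg]
        exact integral_withDensity_eq_integral_smul hgm.nnnorm F
      refine Eq.trans ?_ (integral_congr_ae ((Lp.coeFn_sub u v).fun_comp norm)).symm
      rw [hF]
      congr with x
      simp [NNReal.smul_def, ← sub_mul, mul_comm (|g x|)]
    rw [h1]
    exact mul_le_mul_of_nonneg_right ContinuousLinearMap.opNorm_lsmul_le dist_nonneg
  · intro u v huv hu h1
    rw [← VectorMeasure.integral_congr_ae huv, h1, VectorMeasure.integral_congr_ae (hae huv)]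

theorem integral_prod_mul_real (μ : SignedMeasure α) (ν : SignedMeasure β) {f : α → ℝ} {g : β → ℝ}
    (hf : Integrable f μ.variation) (hg : Integrable g ν.variation) :
    ∫ᵛ p, f p.1 * g p.2 ∂•(μ.prod ν (ContinuousLinearMap.lsmul ℝ ℝ)) =
      (∫ᵛ x, f x ∂•μ) * ∫ᵛ y, g y ∂•ν := by
  set μp := μ.toJordanDecomposition.posPart
  set μn := μ.toJordanDecomposition.negPart
  set νp := ν.toJordanDecomposition.posPart
  set νn := ν.toJordanDecomposition.negPart
  -- Expanding both Jordan decompositions reduces the claim to Fubini for four products of finite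
  -- positive measures.
  have key : μ.prod ν (ContinuousLinearMap.lsmul ℝ ℝ) =
      ((μp.prod νp).toSignedMeasure + (μn.prod νn).toSignedMeasure) -
        ((μp.prod νn).toSignedMeasure + (μn.prod νp).toSignedMeasure) := by
    refine VectorMeasure.prod_eq_of_forall_apply_prod fun s t hs ht => ?_
    rw [SignedMeasure.apply_eq_posPart_real_sub_negPart_real _ hs,
      SignedMeasure.apply_eq_posPart_real_sub_negPart_real _ ht]
    simp only [_root_.sub_apply, _root_.add_apply,
      Measure.toSignedMeasure_apply_measurable (hs.prod ht), measureReal_prod_prod]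
    simp only [ContinuousLinearMap.lsmul_apply, smul_eq_mul]
    ring
  have hfp := hf.mono_measure (posPart_le_variation μ)
  have hfn := hf.mono_measure (negPart_le_variation μ)
  have hgp := hg.mono_measure (posPart_le_variation ν)
  have hgn := hg.mono_measure (negPart_le_variation ν)
  have hpp := (hfp.mul_prod hgp)
  have hpn := (hfp.mul_prod hgn)
  have hnp := (hfn.mul_prod hgp)
  have hnn := (hfn.mul_prod hgn)
  rw [key, VectorMeasure.integral_sub_vectorMeasure, VectorMeasure.integral_add_vectorMeasure,
    VectorMeasure.integral_add_vectorMeasure]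
  · simp only [integral_toSignedMeasure', MeasureTheory.integral_prod_mul,
      integral_eq_posPart_sub_negPart μ hf, integral_eq_posPart_sub_negPart ν hg]
    ring
  · simpa [VectorMeasure.Integrable] using hpn
  · simpa [VectorMeasure.Integrable] using hnp
  · simpa [VectorMeasure.Integrable] using hpp
  · simpa [VectorMeasure.Integrable] using hnn
  · refine (Integrable.add_measure ?_ ?_).mono_measure VectorMeasure.variation_add_le
    · simpa using hpp
    · simpa using hnn
  · refine (Integrable.add_measure ?_ ?_).mono_measure VectorMeasure.variation_add_le
    · simpa using hpn
    · simpa using hnp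

open ProbabilityTheory Set

theorem mem_interior_integrableExpSet {μ : Measure α} {X : α → ℝ} {U : Set ℝ} (hU : IsOpen U)
    (h : ∀ r ∈ U, Integrable (fun x => Real.exp (r * X x)) μ) {r : ℝ} (hr : r ∈ U) :
    r ∈ interior (integrableExpSet X μ) :=
  interior_maximal (fun r hr => h r hr) hU hr

theorem integral_exp_eq_mgf_sub_mgf (κ : SignedMeasure α) {X : α → ℝ} {r : ℝ}
    (h : Integrable (fun x => Real.exp (r * X x)) κ.variation) :
    ∫ᵛ x, Real.exp (r * X x) ∂•κ =
      mgf X κ.toJordanDecomposition.posPart r - mgf X κ.toJordanDecomposition.negPart r :=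
  integral_eq_posPart_sub_negPart κ h

theorem analyticOnNhd_integral_exp (κ : SignedMeasure α) {X : α → ℝ} {U : Set ℝ} (hU : IsOpen U)
    (h : ∀ r ∈ U, Integrable (fun x => Real.exp (r * X x)) κ.variation) :
    AnalyticOnNhd ℝ (fun r => ∫ᵛ x, Real.exp (r * X x) ∂•κ) (U) := by
  refine AnalyticOnNhd.congr hU (f := fun r => mgf X κ.toJordanDecomposition.posPart r -
    mgf X κ.toJordanDecomposition.negPart r) ?_
    fun r hr => (integral_exp_eq_mgf_sub_mgf κ (h r hr)).symm
  intro r hr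
  exact (analyticAt_mgf (mem_interior_integrableExpSet hU
      (fun r hr => (h r hr).mono_measure (posPart_le_variation κ)) hr)).sub
    (analyticAt_mgf (mem_interior_integrableExpSet hU
      (fun r hr => (h r hr).mono_measure (negPart_le_variation κ)) hr))

/-- Identity theorem on the strip over `U`: both sides are analytic there and agree on a real
interval. -/
theorem complexMGF_eqOn_of_mgf_eqOn {μ ν : Measure α} {X : α → ℝ} {U : Set ℝ} (hU : IsOpen U)
    (hc : Convex ℝ U)
    (hμ : ∀ r ∈ U, Integrable (fun x => Real.exp (r * X x)) μ)
    (hν : ∀ r ∈ U, Integrable (fun x => Real.exp (r * X x)) ν)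
    (h : ∀ r ∈ U, mgf X μ r = mgf X ν r) :
    EqOn (complexMGF X μ) (complexMGF X ν) {z | z.re ∈ U} := by
  rcases U.eq_empty_or_nonempty with he | ⟨t, ht⟩
  · simp [he]
  refine AnalyticOnNhd.eqOn_of_preconnected_of_frequently_eq
    (fun z hz => analyticAt_complexMGF (mem_interior_integrableExpSet hU hμ hz))
    (fun z hz => analyticAt_complexMGF (mem_interior_integrableExpSet hU hν hz))
    (hc.linear_preimage Complex.reLm).isPreconnected
    (z₀ := (t : ℂ)) (by simpa using ht) ?_
  have h_real : ∃ᶠ (x : ℝ) in 𝓝[≠] t, complexMGF X μ x = complexMGF X ν x := by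
    refine Filter.Eventually.frequently ?_
    filter_upwards [nhdsWithin_le_nhds (hU.mem_nhds ht)] with r hr
    rw [complexMGF_ofReal, complexMGF_ofReal, h r hr]
  have ht' : Tendsto (fun r : ℝ => (r : ℂ)) (𝓝[≠] t) (𝓝[≠] (t : ℂ)) := by
    refine tendsto_nhdsWithin_iff.2 ⟨Complex.continuous_ofReal.continuousAt.tendsto.mono_left
      nhdsWithin_le_nhds, ?_⟩
    filter_upwards [self_mem_nhdsWithin] with r hr
    simpa using hr
  exact ht'.frequently h_real

/-- The images of the positive and negative parts have the same characteristic function: since `0 ∈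
U`, the point `I` lies in the strip to which equality of the moment generating functions extends. -/
theorem map_eq_zero_of_integral_exp_eq_zero {n : ℕ} (κ : SignedMeasure α)
    {L : α → EuclideanSpace ℝ (Fin n)} (hL : Measurable L)
    (h : ∀ t, ∃ U, IsOpen U ∧ Convex ℝ U ∧ 0 ∈ U ∧ ∀ r ∈ U,
      Integrable (fun x => Real.exp (r * inner ℝ (L x) t)) κ.variation ∧
        ∫ᵛ x, Real.exp (r * inner ℝ (L x) t) ∂•κ = 0) :
    κ.map L = 0 := by
  have key : κ.toJordanDecomposition.posPart.map L = κ.toJordanDecomposition.negPart.map L := by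
    refine Measure.ext_of_charFun (funext fun t => ?_)
    obtain ⟨U, hU, hc, h0, hr⟩ := h t
    have hp := fun r (hr' : r ∈ U) => (hr r hr').1.mono_measure (posPart_le_variation κ)
    have hn := fun r (hr' : r ∈ U) => (hr r hr').1.mono_measure (negPart_le_variation κ)
    have := complexMGF_eqOn_of_mgf_eqOn hU hc hp hn (fun r hr' => by
      have := integral_exp_eq_mgf_sub_mgf κ (hr r hr').1
      rw [(hr r hr').2] at this
      linarith) (x := Complex.I) (by simpa using h0)
    rw [charFun_apply, charFun_apply, integral_map hL.aemeasurable (by fun_prop),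
      integral_map hL.aemeasurable (by fun_prop)]
    simpa only [complexMGF, mul_comm Complex.I] using this
  ext s hs
  rw [VectorMeasure.map_apply _ hL hs,
    SignedMeasure.apply_eq_posPart_real_sub_negPart_real _ (hL hs),
    ← map_measureReal_apply hL hs, ← map_measureReal_apply hL hs, key]
  simp

end SignedIntegral

variable {n : ℕ}

/-! ### Cells of the sphere and where the constructed measures live. -/

section Concentration

theorem isConcentratedOn_iff_ae {μ : SMeas n} {A : Set (Euc n)} (hA : MeasurableSet A) :
    IsConcentratedOn μ A ↔ ∀ᵐ x ∂μ.variation, x ∈ A := by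
  rw [ae_iff, show {x | ¬ x ∈ A} = Aᶜ from rfl,
    VectorMeasure.variation_apply_eq_zero hA.compl, IsConcentratedOn]
  exact ⟨fun h t h1 h2 => h t h2 h1, fun h t h1 h2 => h t h2 h1⟩

theorem measurableSet_unitSphere : MeasurableSet (unitSphere n) :=
  Metric.isClosed_sphere.measurableSet

theorem measurableSet_sphereCell (E : Finset (Fin n)) : MeasurableSet (sphereCell E) :=
  (measurableSet_cell E).inter measurableSet_unitSphere

theorem ae_map {μ : SMeas n} {φ : Euc n → Euc n} (hφ : Measurable φ) {A : Set (Euc n)}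
    (hA : MeasurableSet A) (h : ∀ᵐ x ∂μ.variation, φ x ∈ A) :
    ∀ᵐ y ∂(μ.map φ).variation, y ∈ A :=
  ae_mono VectorMeasure.variation_map_le ((ae_map_iff hφ.aemeasurable hA).2 h)

theorem ae_sphProj {μ : SMeas n} {A : Set (Euc n)} (hA : MeasurableSet A)
    (h : ∀ᵐ x ∂μ.variation, x ≠ 0 → ‖x‖⁻¹ • x ∈ A) :
    ∀ᵐ y ∂(sphProj μ).variation, y ∈ A := by
  refine ae_map measurable_normalize hA (ae_mono VectorMeasure.variation_WithDensity_le ?_)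
  refine (ae_withDensity_iff (by fun_prop)).2 ?_
  rw [VectorMeasure.variation_transpose_lsmul]
  filter_upwards [h] with x hx hx0
  exact hx (by simpa using hx0)

theorem ae_mconv {μ ν : SMeas n} {A B C : Set (Euc n)} (hC : MeasurableSet C)
    (hμ : ∀ᵐ x ∂μ.variation, x ∈ A) (hν : ∀ᵐ x ∂ν.variation, x ∈ B)
    (h : ∀ x ∈ A, ∀ y ∈ B, hadamard x y ∈ C) : ∀ᵐ z ∂(mconv μ ν).variation, z ∈ C := by
  refine ae_mono VectorMeasure.variation_map_le
    ((ae_map_iff measurable_hadamard.aemeasurable hC).2 ?_)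
  refine ae_mono VectorMeasure.variation_prod_le (Measure.ae_smul_measure ?_ _)
  filter_upwards [Measure.quasiMeasurePreserving_fst.ae hμ,
    Measure.quasiMeasurePreserving_snd.ae hν] with p h1 h2 using h _ h1 _ h2

theorem hadamard_mem_cell {E F : Finset (Fin n)} {x y : Euc n} (hx : x ∈ cell E)
    (hy : y ∈ cell F) : hadamard x y ∈ cell (E ∩ F) := fun i => by
  simp [hadamard, ← hx i, ← hy i]

theorem normalize_mem_unitSphere {x : Euc n} (hx : x ≠ 0) : ‖x‖⁻¹ • x ∈ unitSphere n := by
  simp [unitSphere, norm_smul, hx]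

theorem normalize_mem_cell {E : Finset (Fin n)} {x : Euc n} (hx0 : x ≠ 0) (hx : x ∈ cell E) :
    ‖x‖⁻¹ • x ∈ cell E := fun i => by
  simp [← hx i, hx0]

theorem ae_sphProj_unitSphere (μ : SMeas n) : ∀ᵐ y ∂(sphProj μ).variation, y ∈ unitSphere n :=
  ae_sphProj measurableSet_unitSphere (.of_forall fun _ hx => normalize_mem_unitSphere hx)

theorem ae_sphProj_sphereCell {μ : SMeas n} {E : Finset (Fin n)}
    (h : ∀ᵐ x ∂μ.variation, x ∈ cell E) : ∀ᵐ y ∂(sphProj μ).variation, y ∈ sphereCell E :=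
  ae_sphProj (measurableSet_sphereCell E) (h.mono fun _ hx hx0 =>
    ⟨normalize_mem_cell hx0 hx, normalize_mem_unitSphere hx0⟩)

theorem ae_sconv_sphereCell {μ ν : SMeas n} {E F : Finset (Fin n)}
    (hμ : ∀ᵐ x ∂μ.variation, x ∈ cell E) (hν : ∀ᵐ x ∂ν.variation, x ∈ cell F) :
    ∀ᵐ y ∂(sconv μ ν).variation, y ∈ sphereCell (E ∩ F) :=
  ae_sphProj_sphereCell (ae_mconv (measurableSet_cell _) hμ hν fun _ hx _ hy =>
    hadamard_mem_cell hx hy)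

theorem ae_component {μ : SMeas n} (E : Finset (Fin n)) :
    ∀ᵐ x ∂(component E μ).variation, x ∈ cell E := by
  rw [component, VectorMeasure.variation_restrict (measurableSet_cell E)]
  exact ae_restrict_mem (measurableSet_cell E)

theorem ae_component_of_ae {μ : SMeas n} (E : Finset (Fin n)) {p : Euc n → Prop}
    (h : ∀ᵐ x ∂μ.variation, p x) : ∀ᵐ x ∂(component E μ).variation, p x := by
  rw [component, VectorMeasure.variation_restrict (measurableSet_cell E)]
  exact ae_restrict_of_ae h

theorem mem_cell_support (x : Euc n) : x ∈ cell (Finset.univ.filter fun i => x i ≠ 0) :=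
  fun i => by simp

theorem IsOfOrder.ae_mem_cell {μ : SMeas n} {E : Finset (Fin n)} (h : IsOfOrder μ E) :
    ∀ᵐ x ∂μ.variation, x ∈ cell E := by
  have : ∀ᵐ x ∂μ.variation, ∀ F : Finset (Fin n), F ≠ E → x ∉ cell F := by
    rw [ae_all_iff]
    intro F
    by_cases hF : F = E
    · simp [hF]
    · simpa [hF, ae_iff] using h.2 F hF
  filter_upwards [this] with x hx
  by_contra hE
  refine hx _ (fun h => hE ?_) (mem_cell_support x)
  rw [← h]
  exact mem_cell_support x

theorem not_mem_cell_empty {x : Euc n} (hx : x ∈ unitSphere n) : x ∉ cell ∅ := by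
  intro h
  have : x = 0 := by
    ext i
    have := h i
    simpa using this
  simp [this, unitSphere] at hx

end Concentration

/-! ### Integrability of the norm. -/

section NormIntegrable

/-- The norm is integrable with respect to the variation of the measure. -/
def NormIntegrable (μ : SMeas n) : Prop := Integrable (fun x : Euc n => ‖x‖) μ.variation

theorem NormIntegrable.of_ae_unitSphere {μ : SMeas n} (h : ∀ᵐ x ∂μ.variation, x ∈ unitSphere n) :
    NormIntegrable μ := by
  refine (integrable_const (1 : ℝ)).congr ?_
  filter_upwards [h] with x hx
  simpa [unitSphere, eq_comm] using hx

theorem NormIntegrable.map {μ : SMeas n} (h : NormIntegrable μ) {φ : Euc n → Euc n}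
    (hφ : Measurable φ) (hle : ∀ x, ‖φ x‖ ≤ ‖x‖) : NormIntegrable (μ.map φ) := by
  refine VectorMeasure.Integrable.map (by fun_prop) ?_
  exact Integrable.mono h (by fun_prop) (.of_forall fun x => by simpa using hle x)

theorem NormIntegrable.component {μ : SMeas n} (h : NormIntegrable μ) (E : Finset (Fin n)) :
    NormIntegrable (component E μ) :=
  VectorMeasure.Integrable.restrict h

theorem NormIntegrable.sphProj (μ : SMeas n) : NormIntegrable (sphProj μ) :=
  .of_ae_unitSphere (ae_sphProj_unitSphere μ)

theorem NormIntegrable.smul {μ : SMeas n} (hμ : NormIntegrable μ) (c : ℝ) :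
    NormIntegrable (c • μ) := by
  rw [NormIntegrable, VectorMeasure.variation_smul]
  exact hμ.smul_measure_nnreal

theorem NormIntegrable.dirac (x : Euc n) : NormIntegrable (VectorMeasure.dirac x (1 : ℝ)) := by
  rw [NormIntegrable, VectorMeasure.variation_dirac]
  simpa using integrable_dirac (by simp)

theorem NormIntegrable.sum {ι : Type*} {s : Finset ι} {μ : ι → SMeas n}
    (h : ∀ i ∈ s, NormIntegrable (μ i)) : NormIntegrable (∑ i ∈ s, μ i) :=
  (integrable_finsetSum_measure.2 h).mono_measure (VectorMeasure.variation_finsetSum_le s μ)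

theorem norm_coordProj_le (E : Finset (Fin n)) (x : Euc n) : ‖coordProj E x‖ ≤ ‖x‖ := by
  rw [EuclideanSpace.norm_eq, EuclideanSpace.norm_eq]
  refine Real.sqrt_le_sqrt (Finset.sum_le_sum fun i _ => ?_)
  by_cases h : i ∈ E <;> simp [coordProj, h, sq_nonneg]

theorem norm_reflect (E : Finset (Fin n)) (x : Euc n) : ‖reflect E x‖ = ‖x‖ := by
  rw [EuclideanSpace.norm_eq, EuclideanSpace.norm_eq]
  congr 1
  refine Finset.sum_congr rfl fun i _ => ?_
  by_cases h : i ∈ E <;> simp [reflect, h]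

theorem norm_hadamard_le (x y : Euc n) : ‖hadamard x y‖ ≤ ‖x‖ * ‖y‖ := by
  rw [EuclideanSpace.norm_eq, EuclideanSpace.norm_eq x, ← Real.sqrt_sq (norm_nonneg y),
    ← Real.sqrt_mul (by positivity), Finset.sum_mul]
  refine Real.sqrt_le_sqrt (Finset.sum_le_sum fun i _ => ?_)
  simp only [hadamard, norm_mul, mul_pow]
  gcongr
  exact PiLp.norm_apply_le y i

theorem NormIntegrable.mconv {μ ν : SMeas n} (hμ : NormIntegrable μ) (hν : NormIntegrable ν) :
    NormIntegrable (mconv μ ν) := by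
  have : Integrable (fun p : Euc n × Euc n => ‖hadamard p.1 p.2‖)
      (μ.variation.prod ν.variation) := by
    refine (Integrable.mul_prod hμ hν).mono
      (measurable_hadamard.norm.aestronglyMeasurable) (.of_forall fun p => ?_)
    simpa using norm_hadamard_le p.1 p.2
  refine ((Integrable.smul_measure this (c := ‖ContinuousLinearMap.lsmul ℝ ℝ (E := ℝ)‖ₑ)
    (by simp)).mono_measure VectorMeasure.variation_prod_le |> fun h =>
    VectorMeasure.Integrable.map (by fun_prop) h)

end NormIntegrable

/-! ### Signed monomials of degree one. -/

section Monomial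

/-- The exponents `a` are positive on `E`, vanish outside `E`, and sum up to one. -/
structure IsWeight (E : Finset (Fin n)) (a : Fin n → ℝ) : Prop where
  pos : ∀ i ∈ E, 0 < a i
  zero : ∀ i ∉ E, a i = 0
  sum : ∑ i, a i = 1

theorem IsWeight.nonneg {E : Finset (Fin n)} {a : Fin n → ℝ} (ha : IsWeight E a) (i : Fin n) :
    0 ≤ a i := by
  by_cases h : i ∈ E
  · exact (ha.pos i h).le
  · exact (ha.zero i h).ge

theorem IsWeight.nonempty {E : Finset (Fin n)} {a : Fin n → ℝ} (ha : IsWeight E a) :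
    E.Nonempty := by
  by_contra h
  rw [Finset.not_nonempty_iff_eq_empty] at h
  have : ∑ i, a i = 0 := Finset.sum_eq_zero fun i _ => ha.zero i (by simp [h])
  linarith [ha.sum]

theorem isWeight_uniform {E : Finset (Fin n)} (hE : E.Nonempty) :
    IsWeight E fun i => if i ∈ E then (E.card : ℝ)⁻¹ else 0 where
  pos i hi := by
    have : 0 < E.card := hE.card_pos
    simp only [hi, if_true]
    positivity
  zero i hi := by simp [hi]
  sum := by
    have : (E.card : ℝ) ≠ 0 := by exact_mod_cast hE.card_pos.ne'
    simp [Finset.sum_ite_mem, this]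

theorem IsWeight.segment {E F : Finset (Fin n)} (hFE : F ⊆ E) {a b : Fin n → ℝ}
    (ha : IsWeight F a) (hb : IsWeight E b) {r : ℝ} (h0 : 0 < r) (h1 : r ≤ 1) :
    IsWeight E fun i => a i + r * (b i - a i) where
  pos i hi := by
    have := ha.nonneg i
    have := hb.pos i hi
    nlinarith
  zero i hi := by simp [ha.zero i (fun h => hi (hFE h)), hb.zero i hi]
  sum := by
    simp [Finset.sum_add_distrib, ← Finset.mul_sum, ha.sum, hb.sum]

/-- The product of the signs over `J` and of the powers `|x_i|^{a_i}`. -/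
noncomputable def monomial (J : Finset (Fin n)) (a : Fin n → ℝ) (x : Euc n) : ℝ :=
  signProd J x * ∏ i, |x i| ^ a i

theorem measurable_real_sign : Measurable Real.sign := by
  unfold Real.sign
  exact Measurable.ite measurableSet_Iio measurable_const
    (Measurable.ite measurableSet_Ioi measurable_const measurable_const)

theorem measurable_signProd (J : Finset (Fin n)) : Measurable (signProd J) :=
  Finset.measurable_fun_prod J fun i _ => measurable_real_sign.comp (by fun_prop)

theorem measurable_monomial (J : Finset (Fin n)) (a : Fin n → ℝ) : Measurable (monomial J a) := by
  unfold monomial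
  have := measurable_signProd J
  fun_prop

theorem real_sign_mul (x y : ℝ) : Real.sign (x * y) = Real.sign x * Real.sign y := by
  rcases lt_trichotomy x 0 with hx | rfl | hx <;> rcases lt_trichotomy y 0 with hy | rfl | hy <;>
    simp [Real.sign_of_neg, Real.sign_of_pos, mul_pos_of_neg_of_neg, mul_neg_of_neg_of_pos,
      mul_neg_of_pos_of_neg, *]

theorem abs_real_sign_le (x : ℝ) : |Real.sign x| ≤ 1 := by
  rcases Real.sign_apply_eq x with h | h | h <;> simp [h]

theorem abs_signProd_le (J : Finset (Fin n)) (x : Euc n) : |signProd J x| ≤ 1 := by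
  rw [signProd, Finset.abs_prod]
  exact Finset.prod_le_one (fun _ _ => abs_nonneg _) fun _ _ => abs_real_sign_le _

theorem signProd_hadamard (J : Finset (Fin n)) (x y : Euc n) :
    signProd J (hadamard x y) = signProd J x * signProd J y := by
  simp [signProd, hadamard, real_sign_mul, Finset.prod_mul_distrib]

theorem monomial_hadamard (J : Finset (Fin n)) (a : Fin n → ℝ) (x y : Euc n) :
    monomial J a (hadamard x y) = monomial J a x * monomial J a y := by
  rw [monomial, signProd_hadamard]
  simp only [monomial, hadamard, abs_mul,
    Real.mul_rpow (abs_nonneg _) (abs_nonneg _), Finset.prod_mul_distrib]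
  ring

theorem monomial_eq_zero {J E : Finset (Fin n)} {a : Fin n → ℝ} (ha : IsWeight E a) {x : Euc n}
    {i : Fin n} (hi : i ∈ E) (hx : x i = 0) : monomial J a x = 0 := by
  rw [monomial, Finset.prod_eq_zero (Finset.mem_univ i), mul_zero]
  rw [hx, abs_zero, Real.zero_rpow (ha.pos i hi).ne']

/-- Strict positivity of the exponents on `E` means that a weight of `E` sees only the cells `F ⊇
E`. -/
theorem monomial_eq_zero_of_mem_cell {J E F : Finset (Fin n)} {a : Fin n → ℝ} (ha : IsWeight E a)
    {x : Euc n} (hx : x ∈ cell F) (h : ¬ E ⊆ F) : monomial J a x = 0 := by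
  obtain ⟨i, hi, hiF⟩ := Finset.not_subset.1 h
  exact monomial_eq_zero ha hi (by simpa [hiF] using hx i)

theorem monomial_smul {J E : Finset (Fin n)} {a : Fin n → ℝ} (ha : IsWeight E a) {c : ℝ}
    (hc : 0 ≤ c) (x : Euc n) : monomial J a (c • x) = c * monomial J a x := by
  rcases hc.eq_or_lt with rfl | hc
  · obtain ⟨i, hi⟩ := ha.nonempty
    simp [monomial_eq_zero ha hi (x := (0 : Euc n)) rfl]
  · have : ∏ i : Fin n, c ^ a i = c := by
      rw [← Real.rpow_sum_of_pos hc, ha.sum, Real.rpow_one]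
    simp only [monomial, signProd, PiLp.smul_apply, smul_eq_mul, real_sign_mul,
      Real.sign_of_pos hc, one_mul, abs_mul, abs_of_pos hc,
      Real.mul_rpow hc.le (abs_nonneg _), Finset.prod_mul_distrib, this]
    ring

theorem abs_monomial_le {J E : Finset (Fin n)} {a : Fin n → ℝ} (ha : IsWeight E a) (x : Euc n) :
    |monomial J a x| ≤ ‖x‖ := by
  rw [monomial, abs_mul, Finset.abs_prod]
  calc _ ≤ 1 * ∏ i, ‖x‖ ^ a i := by
        refine mul_le_mul (abs_signProd_le J x) (Finset.prod_le_prod (fun _ _ => abs_nonneg _)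
          fun i _ => ?_) (Finset.prod_nonneg fun _ _ => abs_nonneg _) zero_le_one
        rw [abs_of_nonneg (by positivity)]
        exact Real.rpow_le_rpow (abs_nonneg _) (PiLp.norm_apply_le x i) (ha.nonneg i)
    _ = ‖x‖ := by
        rw [one_mul, ← Real.rpow_sum_of_nonneg (norm_nonneg x) fun i _ => ha.nonneg i, ha.sum,
          Real.rpow_one]

theorem monomial_coordProj {J E F : Finset (Fin n)} {a : Fin n → ℝ} (ha : IsWeight E a)
    (hJ : J ⊆ F) (hE : E ⊆ F) (x : Euc n) : monomial J a (coordProj F x) = monomial J a x := by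
  rw [monomial, monomial]
  congr 1
  · exact Finset.prod_congr rfl fun i hi => by simp [coordProj, hJ hi]
  · refine Finset.prod_congr rfl fun i _ => ?_
    by_cases hi : i ∈ F
    · simp [coordProj, hi]
    -- A coordinate erased by the projection has exponent zero and contributes `0 ^ 0 = 1`.
    · simp [ha.zero i (fun h => hi (hE h))]

theorem monomial_reflect (J F : Finset (Fin n)) (a : Fin n → ℝ) (x : Euc n) :
    monomial J a (reflect F x) = (-1) ^ (J ∩ F).card * monomial J a x := by
  have h1 : ∀ i, |reflect F x i| = |x i| := fun i => by
    by_cases h : i ∈ F <;> simp [reflect, h]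
  have h2 : ∀ i, Real.sign (reflect F x i) = (if i ∈ F then -1 else 1) * Real.sign (x i) :=
    fun i => by by_cases h : i ∈ F <;> simp [reflect, h, Real.sign_neg]
  simp only [monomial, signProd, h1, h2, Finset.prod_mul_distrib]
  rw [← Finset.prod_filter, Finset.prod_const, Finset.filter_mem_eq_inter]
  ring

end Monomial

/-! ### The transform and its behaviour under projection, reflection and convolution. -/

section Transform

/-- The integral of a monomial. -/
noncomputable def transform (μ : SMeas n) (J : Finset (Fin n)) (a : Fin n → ℝ) : ℝ :=
  ∫ᵛ x, monomial J a x ∂•μ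

variable {μ ν : SMeas n} {E F J : Finset (Fin n)} {a : Fin n → ℝ}

theorem NormIntegrable.monomial (hμ : NormIntegrable μ) (ha : IsWeight E a) :
    Integrable (monomial J a) μ.variation :=
  Integrable.mono hμ (measurable_monomial J a).aestronglyMeasurable
    (.of_forall fun x => by simpa using abs_monomial_le ha x)

theorem transform_zero : transform (0 : SMeas n) J a = 0 :=
  VectorMeasure.integral_zero_vectorMeasure

theorem transform_add (hμ : NormIntegrable μ) (hν : NormIntegrable ν) (ha : IsWeight E a) :
    transform (μ + ν) J a = transform μ J a + transform ν J a :=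
  VectorMeasure.integral_add_vectorMeasure (hμ.monomial ha) (hν.monomial ha)

theorem transform_smul (c : ℝ) : transform (c • μ) J a = c * transform μ J a :=
  VectorMeasure.integral_smul_vectorMeasure _ _

theorem transform_sum {ι : Type*} {s : Finset ι} {μ : ι → SMeas n}
    (h : ∀ i ∈ s, NormIntegrable (μ i)) (ha : IsWeight E a) :
    transform (∑ i ∈ s, μ i) J a = ∑ i ∈ s, transform (μ i) J a :=
  VectorMeasure.integral_finsetSum_vectorMeasure fun i hi => (h i hi).monomial ha

theorem transform_dirac (x : Euc n) :
    transform (VectorMeasure.dirac x (1 : ℝ)) J a = monomial J a x := by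
  rw [transform, VectorMeasure.integral_dirac]
  simp

theorem transform_eq_zero (h : ∀ᵐ x ∂μ.variation, monomial J a x = 0) : transform μ J a = 0 :=
  VectorMeasure.integral_eq_zero_of_ae h

theorem transform_map (hμ : NormIntegrable μ) (ha : IsWeight E a) {φ : Euc n → Euc n}
    (hφ : Measurable φ) (hle : ∀ x, ‖φ x‖ ≤ ‖x‖) :
    transform (μ.map φ) J a = ∫ᵛ x, monomial J a (φ x) ∂•μ :=
  VectorMeasure.integral_map hφ (measurable_monomial J a).aestronglyMeasurable
    (Integrable.mono hμ ((measurable_monomial J a).comp hφ).aestronglyMeasurable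
      (.of_forall fun x => by simpa using (abs_monomial_le ha _).trans (hle x)))

theorem transform_map_coordProj (hμ : NormIntegrable μ) (ha : IsWeight E a) (hJ : J ⊆ F)
    (hE : E ⊆ F) : transform (μ.map (coordProj F)) J a = transform μ J a := by
  rw [transform_map hμ ha (measurable_coordProj F) (norm_coordProj_le F)]
  simp only [monomial_coordProj ha hJ hE]
  rfl

theorem transform_map_reflect (hμ : NormIntegrable μ) (ha : IsWeight E a) (F : Finset (Fin n)) :
    transform (μ.map (reflect F)) J a = (-1) ^ (J ∩ F).card * transform μ J a := by
  rw [transform_map hμ ha (measurable_reflect F) fun x => (norm_reflect F x).le]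
  simp only [monomial_reflect]
  exact VectorMeasure.integral_fun_smul _ _ _ _

theorem monomial_normalize_mul (ha : IsWeight E a) (x : Euc n) :
    monomial J a (‖x‖⁻¹ • x) * ‖x‖ = monomial J a x := by
  rcases eq_or_ne x 0 with rfl | hx
  · obtain ⟨i, hi⟩ := ha.nonempty
    simp [monomial_eq_zero ha hi (x := (0 : Euc n)) rfl]
  · have : ‖x‖ ≠ 0 := by simpa using hx
    rw [monomial_smul ha (by positivity)]
    field_simp

theorem transform_sphProj (hμ : NormIntegrable μ) (ha : IsWeight E a) :
    transform (sphProj μ) J a = transform μ J a := by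
  have hm : Measurable fun x : Euc n => ‖x‖ := measurable_norm
  have hi : Integrable (fun x => monomial J a (‖x‖⁻¹ • x))
      (μ.withDensity (fun x => ‖x‖) (ContinuousLinearMap.lsmul ℝ ℝ)).variation := by
    rw [integrable_withDensity_real_iff μ hm hμ]
    simpa only [monomial_normalize_mul ha] using hμ.monomial ha
  rw [transform, sphProj, VectorMeasure.integral_map measurable_normalize
    (measurable_monomial J a).aestronglyMeasurable hi, integral_withDensity_real μ hm hμ hi]
  simp only [monomial_normalize_mul ha]
  rfl

theorem transform_mconv (hμ : NormIntegrable μ) (hν : NormIntegrable ν) (ha : IsWeight E a) :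
    transform (mconv μ ν) J a = transform μ J a * transform ν J a := by
  have hi : Integrable (fun p : Euc n × Euc n => monomial J a (hadamard p.1 p.2))
      (μ.prod ν (ContinuousLinearMap.lsmul ℝ ℝ)).variation := by
    simp only [monomial_hadamard]
    exact (((hμ.monomial ha).mul_prod (hν.monomial ha)).smul_measure
      (c := ‖ContinuousLinearMap.lsmul ℝ ℝ (E := ℝ)‖ₑ) (by simp)).mono_measure
        VectorMeasure.variation_prod_le
  rw [transform, mconv, VectorMeasure.integral_map measurable_hadamard
    (measurable_monomial J a).aestronglyMeasurable hi]
  simp only [monomial_hadamard]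
  exact integral_prod_mul_real μ ν (hμ.monomial ha) (hν.monomial ha)

theorem transform_sconv (hμ : NormIntegrable μ) (hν : NormIntegrable ν) (ha : IsWeight E a) :
    transform (sconv μ ν) J a = transform μ J a * transform ν J a := by
  rw [sconv, transform_sphProj (hμ.mconv hν) ha, transform_mconv hμ hν ha]

/-- Cells that do not contain `E` contribute nothing to the integral, and those strictly containing
`E` are null by assumption. -/
theorem transform_component (ha : IsWeight E a)
    (h : ∀ᵐ x ∂μ.variation, ∀ F, E ⊂ F → x ∉ cell F) :
    transform (component E μ) J a = transform μ J a := by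
  rw [transform, component, ← VectorMeasure.integral_indicator (measurableSet_cell E)]
  refine VectorMeasure.integral_congr_ae ?_
  filter_upwards [h] with x hx
  by_cases hxE : x ∈ cell E
  · simp [hxE]
  · rw [Set.indicator_of_notMem hxE]
    refine (monomial_eq_zero_of_mem_cell ha (mem_cell_support x) fun hE => ?_).symm
    rcases hE.eq_or_ssubset with hE | hE
    · rw [hE] at hxE
      exact hxE (mem_cell_support x)
    · exact hx _ hE (mem_cell_support x)

theorem neg_one_pow_mul_transform_eq (hμ : NormIntegrable μ) (ha : IsWeight E a)
    {F : Finset (Fin n)} {c : ℝ} (h : μ.map (reflect F) = c • μ) :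
    (-1) ^ (J ∩ F).card * transform μ J a = c * transform μ J a := by
  rw [← transform_map_reflect hμ ha, h, transform_smul]

end Transform

/-! ### Analyticity in the weight and injectivity of the transform. -/

section Uniqueness

variable {μ ν : SMeas n} {E J : Finset (Fin n)} {a c : Fin n → ℝ}

/-- The parameters for which the point of the line through `a` with direction `c` has positive
coordinates on `E`. -/
def weightLine (E : Finset (Fin n)) (a c : Fin n → ℝ) : Set ℝ := {r | ∀ i ∈ E, 0 < a i + r * c i}

theorem isOpen_weightLine : IsOpen (weightLine E a c) := by
  have : weightLine E a c = ⋂ i ∈ E, {r | 0 < a i + r * c i} := by ext; simp [weightLine]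
  rw [this]
  exact isOpen_biInter_finset fun i _ => isOpen_lt continuous_const (by fun_prop)

theorem convex_weightLine : Convex ℝ (weightLine E a c) := by
  intro r hr s hs p q hp hq hpq i hi
  have h1 := hr i hi
  have h2 := hs i hi
  have : a i + (p • r + q • s) * c i = p * (a i + r * c i) + q * (a i + s * c i) := by
    simp only [smul_eq_mul]
    linear_combination (-a i) * hpq
  rw [this]
  rcases hp.eq_or_lt with rfl | hp
  · have : q = 1 := by linarith
    simpa [this] using h2
  · have := mul_pos hp h1
    have := mul_nonneg hq h2.le
    linarith

theorem IsWeight.line (ha : IsWeight E a) (hc : ∀ i ∉ E, c i = 0) (hs : ∑ i, c i = 0) {r : ℝ}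
    (hr : r ∈ weightLine E a c) : IsWeight E fun i => a i + r * c i where
  pos := hr
  zero i hi := by simp [ha.zero i hi, hc i hi]
  sum := by simp [Finset.sum_add_distrib, ← Finset.mul_sum, ha.sum, hs]

theorem IsWeight.zero_mem_weightLine (ha : IsWeight E a) : 0 ∈ weightLine E a c :=
  fun i hi => by simpa using ha.pos i hi

/-- Moving the weight along a line is an exponential tilt, so transforms become moment generating
functions under a fixed density. At a zero coordinate in `E` both sides vanish, whatever the value
of `log 0`. -/
theorem exp_mul_monomial (ha : IsWeight E a) (hc : ∀ i ∉ E, c i = 0) {r : ℝ}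
    (hr : r ∈ weightLine E a c) (x : Euc n) :
    Real.exp (r * ∑ i, c i * Real.log |x i|) * monomial J a x =
      monomial J (fun i => a i + r * c i) x := by
  by_cases hx : ∃ i ∈ E, x i = 0
  · obtain ⟨i, hi, hxi⟩ := hx
    rw [monomial_eq_zero ha hi hxi, mul_zero, monomial, Finset.prod_eq_zero (Finset.mem_univ i),
      mul_zero]
    rw [hxi, abs_zero, Real.zero_rpow (hr i hi).ne']
  · push Not at hx
    rw [monomial, monomial, mul_left_comm, Finset.mul_sum, Real.exp_sum, ← Finset.prod_mul_distrib]
    congr 1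
    refine Finset.prod_congr rfl fun i _ => ?_
    by_cases hi : i ∈ E
    · have : 0 < |x i| := abs_pos.2 (hx i hi)
      rw [Real.rpow_add this, Real.rpow_def_of_pos this (r * c i), mul_comm]
      congr 2
      ring
    · simp [hc i hi]

/-- A product of two transforms vanishes only if one of the factors does. -/
theorem transform_eq_zero_or_of_mul_eq_zero (hμ : NormIntegrable μ) (hν : NormIntegrable ν)
    (h : ∀ a, IsWeight E a → transform μ J a * transform ν J a = 0) :
    (∀ a, IsWeight E a → transform μ J a = 0) ∨ ∀ a, IsWeight E a → transform ν J a = 0 := by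
  by_contra! hcon
  obtain ⟨⟨a, ha, hμa⟩, b, hb, hνb⟩ := hcon
  -- Join the two weights where the factors are nonzero: `r = 0` gives `a` and `r = 1` gives `b`. On
  -- the open interval of admissible `r` the product of two analytic functions vanishes.
  set c : Fin n → ℝ := fun i => b i - a i with hc_def
  have hc : ∀ i ∉ E, c i = 0 := fun i hi => by simp [hc_def, ha.zero i hi, hb.zero i hi]
  have hs : ∑ i, c i = 0 := by simp [hc_def, ha.sum, hb.sum]
  have h1 : (1 : ℝ) ∈ weightLine E a c := fun i hi => by simpa [hc_def] using hb.pos i hi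
  have hb' : (fun i => a i + 1 * c i) = b := by ext i; simp [hc_def]
  have han {ρ : SMeas n} (hρ : NormIntegrable ρ) : AnalyticOnNhd ℝ
      (fun r => transform ρ J fun i => a i + r * c i) (weightLine E a c) := by
    have hm := measurable_monomial J a
    have hi := hρ.monomial (J := J) ha
    have hint : ∀ r ∈ weightLine E a c,
        Integrable (fun x : Euc n => Real.exp (r * ∑ i, c i * Real.log |x i|))
          (ρ.withDensity (monomial J a) (ContinuousLinearMap.lsmul ℝ ℝ)).variation := by
      intro r hr
      rw [integrable_withDensity_real_iff ρ hm hi]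
      simpa only [exp_mul_monomial ha hc hr] using hρ.monomial (ha.line hc hs hr)
    refine (analyticOnNhd_integral_exp _ isOpen_weightLine hint).congr isOpen_weightLine
      fun r hr => ?_
    simp only [transform]
    rw [integral_withDensity_real ρ hm hi (hint r hr)]
    simp only [exp_mul_monomial ha hc hr]
  rcases AnalyticOnNhd.eq_zero_or_eq_zero_of_mul_eq_zero (han hμ) (han hν)
    (fun r hr => h _ (ha.line hc hs hr)) convex_weightLine.isPreconnected with h0 | h0
  · exact hμa (by simpa using h0 0 ha.zero_mem_weightLine)
  · exact hνb (by simpa only [hb'] using h0 1 h1)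

/-- The logarithms of the absolute values of the coordinates in `E`, centred. -/
noncomputable def centredLog (E : Finset (Fin n)) (x : Euc n) : EuclideanSpace ℝ (Fin n) :=
  WithLp.toLp 2 fun i =>
    if i ∈ E then Real.log |x i| - (∑ j ∈ E, Real.log |x j|) / E.card else 0

theorem measurable_centredLog (E : Finset (Fin n)) : Measurable (centredLog E) := by
  apply (WithLp.measurable_toLp 2 _).comp
  refine measurable_pi_lambda _ fun i => ?_
  by_cases h : i ∈ E <;> simp only [h, if_true, if_false] <;> fun_prop

/-- The point of the sphere with signs `s` and centred logarithms `y`. -/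
noncomputable def signedExp (s : Fin n → ℝ) (y : EuclideanSpace ℝ (Fin n)) : Euc n :=
  ‖(WithLp.toLp 2 fun i => s i * Real.exp (y i) : Euc n)‖⁻¹ •
    (WithLp.toLp 2 fun i => s i * Real.exp (y i) : Euc n)

theorem measurable_signedExp (s : Fin n → ℝ) : Measurable (signedExp s) := by
  unfold signedExp
  fun_prop

theorem signedExp_centredLog {s : Fin n → ℝ} {x : Euc n} (hx : x ∈ sphereCell E)
    (hs : ∀ i, Real.sign (x i) = s i) : signedExp s (centredLog E x) = x := by
  set M := (∑ j ∈ E, Real.log |x j|) / E.card with hM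
  have h1 : (WithLp.toLp 2 fun i => s i * Real.exp (centredLog E x i) : Euc n) =
      Real.exp (-M) • x := by
    ext i
    by_cases hi : i ∈ E
    · have hxi : x i ≠ 0 := (hx.1 i).2 hi
      have : Real.sign (x i) * |x i| = x i := by
        rcases lt_or_gt_of_ne hxi with h | h
        · rw [Real.sign_of_neg h, abs_of_neg h]; ring
        · rw [Real.sign_of_pos h, abs_of_pos h]; ring
      simp only [centredLog, hi, if_true, ← hM, sub_eq_add_neg, Real.exp_add,
        Real.exp_log (abs_pos.2 hxi), ← hs, PiLp.smul_apply, smul_eq_mul]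
      rw [← mul_assoc, this, mul_comm]
    · have hxi : x i = 0 := by simpa [hi] using hx.1 i
      simp [← hs, hxi]
  have hn : ‖x‖ = 1 := by simpa [unitSphere] using hx.2
  rw [signedExp, h1, norm_smul, hn, smul_smul]
  simp

theorem map_eq_self_of_ae_eq {κ : SMeas n} {φ : Euc n → Euc n} (hφ : Measurable φ)
    (h : ∀ᵐ x ∂κ.variation, φ x = x) : κ.map φ = κ := by
  have key {B : Set (Euc n)} (hB : MeasurableSet B) :
      κ B = ∫ᵛ x, B.indicator (fun _ => (1 : ℝ)) x ∂•κ := by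
    rw [VectorMeasure.integral_indicator hB, VectorMeasure.setIntegral_const]
    simp
  ext B hB
  rw [VectorMeasure.map_apply _ hφ hB, key hB, key (hφ hB)]
  refine VectorMeasure.integral_congr_ae ?_
  filter_upwards [h] with x hx
  have : x ∈ φ ⁻¹' B ↔ x ∈ B := by rw [Set.mem_preimage, hx]
  by_cases hb : x ∈ B
  · rw [Set.indicator_of_mem hb, Set.indicator_of_mem (this.2 hb)]
  · rw [Set.indicator_of_notMem hb, Set.indicator_of_notMem (mt this.1 hb)]

/-- For a sign vector `s` of `E` and `x` in the cell of `E`, the product over `E` is `2^|E|` times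
the indicator that `x` has signs `s`. This combination of monomials thus isolates one orthant. -/
theorem sum_powerset_signProd (E : Finset (Fin n)) (s : Fin n → ℝ) (a : Fin n → ℝ) (x : Euc n) :
    ∑ J ∈ E.powerset, (∏ i ∈ J, s i) * monomial J a x =
      (∏ i ∈ E, (1 + s i * Real.sign (x i))) * ∏ i, |x i| ^ a i := by
  rw [Finset.prod_one_add, Finset.sum_mul]
  refine Finset.sum_congr rfl fun J _ => ?_
  rw [monomial, signProd, Finset.prod_mul_distrib, mul_assoc]

theorem sign_eq_of_prod_ne_zero {s : Fin n → ℝ} (hs : s ∈ signVectors E) {x : Euc n}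
    (hx : x ∈ cell E) (h : ∏ i ∈ E, (1 + s i * Real.sign (x i)) ≠ 0) (i : Fin n) :
    Real.sign (x i) = s i := by
  have hsi := Fintype.mem_piFinset.1 hs i
  by_cases hi : i ∈ E
  · have h1 := Finset.prod_ne_zero_iff.1 h i hi
    simp only [hi, if_true, Finset.mem_insert, Finset.mem_singleton] at hsi
    rcases hsi with hsi | hsi <;> rcases Real.sign_apply_eq_of_ne_zero _ ((hx i).2 hi) with h2 | h2
      <;> rw [hsi, h2] at h1 ⊢ <;> norm_num at h1
  · have : x i = 0 := by simpa [hi] using hx i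
    simp only [hi, if_false, Finset.mem_singleton] at hsi
    simp [hsi, this]

/-- The measures on a cell of the sphere are determined by their transforms. -/
theorem eq_zero_of_transform_eq_zero_of_sphereCell (hE : E.Nonempty)
    (hμ : ∀ᵐ x ∂μ.variation, x ∈ sphereCell E)
    (h : ∀ J ⊆ E, ∀ a, IsWeight E a → transform μ J a = 0) : μ = 0 := by
  have hμn : NormIntegrable μ := .of_ae_unitSphere (hμ.mono fun x hx => hx.2)
  have hk : (E.card : ℝ) ≠ 0 := by exact_mod_cast hE.card_pos.ne'
  obtain ⟨u, hu⟩ : ∃ u, IsWeight E u := ⟨_, isWeight_uniform hE⟩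
  have main : ∀ s ∈ signVectors E, ∀ᵐ x ∂μ.variation,
      ∑ J ∈ E.powerset, (∏ i ∈ J, s i) * monomial J u x = 0 := by
    intro s hs
    set g : Euc n → ℝ := fun x => ∑ J ∈ E.powerset, (∏ i ∈ J, s i) * monomial J u x with hg
    have hgm : Measurable g := Finset.measurable_fun_sum _ fun J _ =>
      (measurable_monomial J u).const_mul _
    have hgi : Integrable g μ.variation := integrable_finsetSum _ fun J _ =>
      (hμn.monomial hu).const_mul _
    -- `κ` is `μ` on the orthant of `s`, with a positive density. Its exponential moments in the
    -- centred logarithms are combinations of transforms of `μ`, hence zero.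
    set κ := μ.withDensity g (ContinuousLinearMap.lsmul ℝ ℝ) with hκ
    have hκv := variation_withDensity_real μ hgi
    have hκ0 : κ.map (centredLog E) = 0 := by
      refine map_eq_zero_of_integral_exp_eq_zero κ (measurable_centredLog E) fun t => ?_
      -- Centring `t` keeps the sum of the weights equal to one; pairing `t` with the centred
      -- logarithms is pairing `c` with the logarithms themselves.
      set c : Fin n → ℝ := fun i => if i ∈ E then t i - (∑ j ∈ E, t j) / E.card else 0 with hc_def
      have hc : ∀ i ∉ E, c i = 0 := fun i hi => by simp [hc_def, hi]
      have hcs : ∑ i, c i = 0 := by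
        simp only [hc_def, Finset.sum_ite_mem, Finset.univ_inter, Finset.sum_sub_distrib,
          Finset.sum_const, nsmul_eq_mul]
        field_simp
        ring
      have hin (x : Euc n) : inner ℝ (centredLog E x) t = ∑ i, c i * Real.log |x i| := by
        simp only [PiLp.inner_apply, centredLog, hc_def, RCLike.inner_apply, conj_trivial,
          mul_ite, ite_mul, mul_zero, zero_mul, Finset.sum_ite_mem, Finset.univ_inter, mul_sub,
          sub_mul, Finset.sum_sub_distrib, ← Finset.sum_mul, ← Finset.mul_sum]
        ring
      refine ⟨weightLine E u c, isOpen_weightLine, convex_weightLine, hu.zero_mem_weightLine,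
        fun r hr => ?_⟩
      have hw := hu.line hc hcs hr
      have he (x : Euc n) : Real.exp (r * inner ℝ (centredLog E x) t) * g x =
          ∑ J ∈ E.powerset, (∏ i ∈ J, s i) * monomial J (fun i => u i + r * c i) x := by
        rw [hg, Finset.mul_sum, hin]
        refine Finset.sum_congr rfl fun J _ => ?_
        rw [← exp_mul_monomial hu hc hr]
        ring
      have hint : Integrable (fun x => Real.exp (r * inner ℝ (centredLog E x) t))
          κ.variation := by
        rw [integrable_withDensity_real_iff μ hgm hgi]
        simp only [he]
        exact integrable_finsetSum _ fun J _ => (hμn.monomial hw).const_mul _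
      refine ⟨hint, ?_⟩
      rw [integral_withDensity_real μ hgm hgi hint]
      simp only [he]
      rw [VectorMeasure.integral_finsetSum _ fun J _ => (hμn.monomial hw).const_mul _]
      refine Finset.sum_eq_zero fun J hJ => ?_
      have := VectorMeasure.integral_fun_smul μ (ContinuousLinearMap.lsmul ℝ ℝ) (∏ i ∈ J, s i)
        (monomial J fun i => u i + r * c i)
      simp only [smul_eq_mul] at this
      rw [this, show ∫ᵛ x, monomial J (fun i => u i + r * c i) x ∂•μ = 0 from
        h J (Finset.mem_powerset.1 hJ) _ hw, mul_zero]
    -- With signs fixed, centring loses only the scale, which the sphere restores; so `κ` is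
    -- recovered from its zero image.
    have hid : ∀ᵐ x ∂κ.variation, signedExp s (centredLog E x) = x := by
      rw [hκv, ae_withDensity_iff hgm.enorm]
      filter_upwards [hμ] with x hx hgx
      refine signedExp_centredLog hx (sign_eq_of_prod_ne_zero hs hx.1 fun h0 => ?_)
      simp [hg, sum_powerset_signProd, h0] at hgx
    have hκ00 : κ = 0 := by
      rw [← map_eq_self_of_ae_eq ((measurable_signedExp s).comp (measurable_centredLog E)) hid]
      ext B hB
      rw [VectorMeasure.map_apply _ ((measurable_signedExp s).comp (measurable_centredLog E)) hB,
        Set.preimage_comp, ← VectorMeasure.map_apply _ (measurable_centredLog E)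
          (measurable_signedExp s hB), hκ0]
      simp
    rw [← VectorMeasure.variation_eq_zero, hκv] at hκ00
    have := (withDensity_eq_zero_iff hgm.enorm.aemeasurable).1 hκ00
    filter_upwards [this] with x hx
    simpa using hx
  -- Each point is tested against its own sign vector, for which the sum is strictly positive.
  have : ∀ᵐ x ∂μ.variation, False := by
    filter_upwards [hμ, (ae_ball_iff (signVectors E).countable_toSet).2 main] with x hx hall
    have hs : (fun i => Real.sign (x i)) ∈ signVectors E := by
      refine Fintype.mem_piFinset.2 fun i => ?_
      by_cases hi : i ∈ E
      · simpa [hi] using Real.sign_apply_eq_of_ne_zero _ ((hx.1 i).2 hi)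
      · have : x i = 0 := by simpa [hi] using hx.1 i
        simp [hi, this]
    have h0 := hall _ hs
    rw [sum_powerset_signProd] at h0
    refine (mul_ne_zero (Finset.prod_ne_zero_iff.2 fun i hi => ?_)
      (Finset.prod_ne_zero_iff.2 fun i _ => ?_)) h0
    · nlinarith [mul_self_nonneg (Real.sign (x i))]
    · by_cases hi : i ∈ E
      · exact (Real.rpow_pos_of_pos (abs_pos.2 ((hx.1 i).2 hi)) _).ne'
      · simp [hu.zero i hi]
  rw [← VectorMeasure.variation_eq_zero]
  simpa using this

/-- The measures on the sphere are determined by their transforms. -/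
theorem eq_zero_of_transform_eq_zero (hμ : ∀ᵐ x ∂μ.variation, x ∈ unitSphere n)
    (h : ∀ E : Finset (Fin n), ∀ J ⊆ E, ∀ a, IsWeight E a → transform μ J a = 0) : μ = 0 := by
  have h0 {E : Finset (Fin n)} (hE : component E μ = 0) : ∀ᵐ x ∂μ.variation, x ∉ cell E := by
    rw [component, ← VectorMeasure.variation_eq_zero,
      VectorMeasure.variation_restrict (measurableSet_cell E), Measure.restrict_eq_zero] at hE
    simpa [ae_iff] using hE
  -- Induction from large cells to small: once the cells strictly containing `E` are null, the
  -- transforms of `μ` with weights of `E` are those of its component on `E`.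
  have main : ∀ E : Finset (Fin n), component E μ = 0 := by
    intro E
    induction E using WellFoundedGT.induction with
    | ind E ih =>
      have hE : ∀ᵐ x ∂(component E μ).variation, x ∈ sphereCell E := by
        filter_upwards [ae_component E, ae_component_of_ae E hμ] with x h1 h2 using ⟨h1, h2⟩
      rcases E.eq_empty_or_nonempty with rfl | hne
      · have : ∀ᵐ x ∂(component ∅ μ).variation, False := by
          filter_upwards [hE] with x hx using not_mem_cell_empty hx.2 hx.1
        rw [← VectorMeasure.variation_eq_zero]
        simpa using this
      · refine eq_zero_of_transform_eq_zero_of_sphereCell hne hE fun J hJ a ha => ?_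
        rw [transform_component ha, h E J hJ a ha]
        simp only [ae_all_iff]
        exact fun F hF => h0 (ih F hF)
  have : ∀ᵐ x ∂μ.variation, False := by
    filter_upwards [ae_all_iff.2 fun E => h0 (main E)] with x hx using hx _ (mem_cell_support x)
  rw [← VectorMeasure.variation_eq_zero]
  simpa using this

end Uniqueness

/-! ### Discrete measures and the witnesses against universality. -/

section DiscreteMeasures

variable {E F J K : Finset (Fin n)} {a : Fin n → ℝ}

theorem ae_sum_smul_dirac {ι : Type*} {s : Finset ι} {c : ι → ℝ} {x : ι → Euc n}
    {A : Set (Euc n)} (hA : MeasurableSet A) (h : ∀ i ∈ s, x i ∈ A) :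
    ∀ᵐ y ∂(∑ i ∈ s, c i • VectorMeasure.dirac (x i) (1 : ℝ)).variation, y ∈ A := by
  refine ae_mono (VectorMeasure.variation_finsetSum_le _ _) ?_
  rw [show {y | y ∈ A} = A from rfl, mem_ae_iff, Measure.finsetSum_apply]
  refine Finset.sum_eq_zero fun i hi => ?_
  rw [VectorMeasure.variation_smul, VectorMeasure.variation_dirac]
  simp [Measure.dirac_apply' _ hA.compl, h i hi]

theorem normIntegrable_sum_smul_dirac {ι : Type*} (s : Finset ι) (c : ι → ℝ) (x : ι → Euc n) :
    NormIntegrable (∑ i ∈ s, c i • VectorMeasure.dirac (x i) (1 : ℝ)) :=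
  .sum fun _ _ => (NormIntegrable.dirac _).smul _

theorem transform_sum_smul_dirac {ι : Type*} (s : Finset ι) (c : ι → ℝ) (x : ι → Euc n)
    (ha : IsWeight E a) : transform (∑ i ∈ s, c i • VectorMeasure.dirac (x i) (1 : ℝ)) J a =
      ∑ i ∈ s, c i * monomial J a (x i) := by
  rw [transform_sum (fun _ _ => (NormIntegrable.dirac _).smul _) ha]
  simp only [transform_smul, transform_dirac]

theorem signVectors_mem_cell {s : Fin n → ℝ} (hs : s ∈ signVectors E) :
    (WithLp.toLp 2 s : Euc n) ∈ cell E := fun i => by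
  have hsi := Fintype.mem_piFinset.1 hs i
  by_cases hi : i ∈ E
  · simp only [hi, if_true, Finset.mem_insert, Finset.mem_singleton] at hsi
    rcases hsi with h | h <;> simp [hi, h]
  · simp only [hi, if_false, Finset.mem_singleton] at hsi
    simp [hi, hsi]

theorem normIntegrable_deltaMeas (E J : Finset (Fin n)) : NormIntegrable (deltaMeas E J) :=
  (normIntegrable_sum_smul_dirac _ _ _).smul _

theorem ae_deltaMeas (E J : Finset (Fin n)) :
    ∀ᵐ x ∂(deltaMeas E J).variation, x ∈ cell E := by
  rw [deltaMeas, VectorMeasure.variation_smul]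
  exact Measure.ae_smul_measure
    (ae_sum_smul_dirac (measurableSet_cell E) fun s hs => signVectors_mem_cell hs) _

theorem monomial_signVector (ha : IsWeight F a) (hF : F ⊆ E) {s : Fin n → ℝ}
    (hs : s ∈ signVectors E) :
    monomial J a (WithLp.toLp 2 s) = signProd J (WithLp.toLp 2 s) := by
  rw [monomial, Finset.prod_eq_one, mul_one]
  intro i _
  have hsi := Fintype.mem_piFinset.1 hs i
  by_cases hi : i ∈ E
  · simp only [hi, if_true, Finset.mem_insert, Finset.mem_singleton] at hsi
    rcases hsi with h | h <;> simp [h]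
  · simp [ha.zero i fun h => hi (hF h)]

/-- Orthogonality of the characters of `{-1, 1}^E`: the sum factorises over coordinates, and a
coordinate in exactly one of `J`, `K` gives the factor `0`. -/
theorem sum_signProd_mul_signProd (hJ : J ⊆ E) (hK : K ⊆ E) :
    ∑ s ∈ signVectors E, signProd J (WithLp.toLp 2 s : Euc n) * signProd K (WithLp.toLp 2 s) =
      if K = J then 2 ^ E.card else 0 := by
  set φ : Fin n → ℝ → ℝ := fun i t =>
    (if i ∈ J then Real.sign t else 1) * (if i ∈ K then Real.sign t else 1) with hφ
  have h1 (s : Fin n → ℝ) : signProd J (WithLp.toLp 2 s : Euc n) *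
      signProd K (WithLp.toLp 2 s) = ∏ i, φ i (s i) := by
    simp only [hφ, Finset.prod_mul_distrib, Finset.prod_ite_mem, Finset.univ_inter]
    rfl
  have hsum (i : Fin n) : ∑ t ∈ (if i ∈ E then ({-1, 1} : Finset ℝ) else {0}), φ i t =
      if i ∈ E then (if i ∈ J ↔ i ∈ K then 2 else 0) else 1 := by
    by_cases hi : i ∈ E
    · have hne : (-1 : ℝ) ≠ 1 := by norm_num
      have hs : Real.sign (-1) = -1 := by rw [Real.sign_neg, Real.sign_one]
      by_cases h2 : i ∈ J <;> by_cases h3 : i ∈ K <;>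
        simp [hφ, hi, h2, h3, Finset.sum_pair hne, hs] <;> norm_num
    · have hiJ : i ∉ J := fun h => hi (hJ h)
      have hiK : i ∉ K := fun h => hi (hK h)
      simp [hφ, hi, hiJ, hiK]
  simp only [h1]
  rw [signVectors, ← Finset.prod_univ_sum]
  simp only [hsum]
  split_ifs with h
  · subst h
    simp
  · obtain ⟨i, hi⟩ : ∃ i, ¬ (i ∈ J ↔ i ∈ K) := by
      by_contra! hcon
      exact h (Finset.ext fun i => (hcon i).symm)
    have hiE : i ∈ E := by
      by_contra hiE
      exact hi ⟨fun h => absurd (hJ h) hiE, fun h => absurd (hK h) hiE⟩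
    exact Finset.prod_eq_zero (Finset.mem_univ i) (by simp [hi, hiE])

theorem transform_deltaMeas (ha : IsWeight F a) (hF : F ⊆ E) (hJ : J ⊆ E) (hK : K ⊆ E) :
    transform (deltaMeas E J) K a = if K = J then 1 else 0 := by
  rw [deltaMeas, transform_smul, transform_sum_smul_dirac _ _ _ ha,
    Finset.sum_congr rfl fun s hs => by rw [monomial_signVector ha hF hs],
    sum_signProd_mul_signProd hJ hK]
  split_ifs <;> simp

/-- The product of the measures `δ_1 - δ_2` over the coordinates in `E` and of `δ_1` over the
other coordinates. -/
noncomputable def differenceMeas (E : Finset (Fin n)) : SMeas n :=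
  ∑ A ∈ E.powerset, (-1 : ℝ) ^ A.card •
    VectorMeasure.dirac (WithLp.toLp 2 fun i => if i ∈ A then 2 else 1 : Euc n) (1 : ℝ)

theorem ae_differenceMeas (E : Finset (Fin n)) :
    ∀ᵐ x ∂(differenceMeas E).variation, x ∈ cell Finset.univ :=
  ae_sum_smul_dirac (measurableSet_cell _) fun A _ i => by
    by_cases h : i ∈ A <;> simp [h]

theorem normIntegrable_differenceMeas (E : Finset (Fin n)) : NormIntegrable (differenceMeas E) :=
  normIntegrable_sum_smul_dirac _ _ _

/-- The product vanishes as soon as some `i ∈ E` has exponent zero, and for a weight of `E` it does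
not. This removes from `cellWitness` the transforms with weights of proper subsets of `E`. -/
theorem transform_differenceMeas (ha : IsWeight F a) :
    transform (differenceMeas E) J a = ∏ i ∈ E, (1 - (2 : ℝ) ^ a i) := by
  rw [differenceMeas, transform_sum_smul_dirac _ _ _ ha]
  simp only [sub_eq_add_neg]
  rw [Finset.prod_one_add]
  refine Finset.sum_congr rfl fun A _ => ?_
  have h1 : signProd J (WithLp.toLp 2 fun i => if i ∈ A then 2 else 1 : Euc n) = 1 :=
    Finset.prod_eq_one fun i _ => by
      by_cases h : i ∈ A <;> simp [h, Real.sign_of_pos]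
  have h2 : ∏ i : Fin n, |(if i ∈ A then (2 : ℝ) else 1)| ^ a i = ∏ i ∈ A, (2 : ℝ) ^ a i := by
    rw [← Finset.prod_subset (Finset.subset_univ A)]
    · exact Finset.prod_congr rfl fun i hi => by simp [hi]
    · intro i _ hi
      simp [hi]
  rw [monomial, h1, one_mul, h2, Finset.prod_neg]

/-- A measure on the cell of `E` whose transforms vanish except those with signs `J` and weights
of `E`. -/
noncomputable def cellWitness (E J : Finset (Fin n)) : SMeas n :=
  sconv (deltaMeas E J) (differenceMeas E)

theorem ae_cellWitness (E J : Finset (Fin n)) :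
    ∀ᵐ x ∂(cellWitness E J).variation, x ∈ sphereCell E := by
  simpa [cellWitness] using ae_sconv_sphereCell (ae_deltaMeas E J) (ae_differenceMeas E)

theorem normIntegrable_cellWitness (E J : Finset (Fin n)) : NormIntegrable (cellWitness E J) :=
  .sphProj _

theorem transform_cellWitness_ne_zero (hJ : J ⊆ E) (ha : IsWeight E a) :
    transform (cellWitness E J) J a ≠ 0 := by
  rw [cellWitness, transform_sconv (normIntegrable_deltaMeas E J)
    (normIntegrable_differenceMeas E) ha, transform_deltaMeas ha subset_rfl hJ hJ,
    transform_differenceMeas ha]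
  simp only [if_true, one_mul]
  refine Finset.prod_ne_zero_iff.2 fun i hi => ?_
  have := Real.one_lt_rpow (x := 2) (by norm_num) (ha.pos i hi)
  linarith

/-- Three causes: if `F ⊄ E` the monomial vanishes on the cell of `E`; if `K ≠ J` the characters are
orthogonal; if `F ⊂ E` strictly the difference factor is zero. -/
theorem transform_cellWitness_eq_zero (hJ : J ⊆ E) (hK : K ⊆ F) (ha : IsWeight F a)
    (h : ¬ (F = E ∧ K = J)) : transform (cellWitness E J) K a = 0 := by
  rw [cellWitness, transform_sconv (normIntegrable_deltaMeas E J)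
    (normIntegrable_differenceMeas E) ha]
  by_cases hF : F ⊆ E
  · rw [transform_deltaMeas ha hF hJ (hK.trans hF), transform_differenceMeas ha]
    by_cases hKJ : K = J
    · obtain ⟨i, hi, hiF⟩ := Finset.not_subset.1 fun hEF => h ⟨hF.antisymm hEF, hKJ⟩
      rw [Finset.prod_eq_zero hi, mul_zero]
      simp [ha.zero i hiF]
    · simp [hKJ]
  · rw [transform_eq_zero, zero_mul]
    filter_upwards [ae_deltaMeas E J] with x hx using monomial_eq_zero_of_mem_cell ha hx hF

end DiscreteMeasures

/-! ### Universality in terms of transforms, and translation into the stated conditions. -/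

section Universality

variable {μ ν : SMeas n} {E F J : Finset (Fin n)} {Fe Fo : Set (Finset (Fin n))}

/-- Some transform of `ν` with signs `J` and a weight of `E` is not zero. -/
def HasNonzeroTransform (ν : SMeas n) (E J : Finset (Fin n)) : Prop :=
  ∃ a, IsWeight E a ∧ transform ν J a ≠ 0

theorem neg_smul_smeas (c : ℝ) (μ : SMeas n) : (-c) • μ = -(c • μ) := by
  ext s _
  simp

theorem transform_eq_zero_of_sconv_eq_zero (hν : NormIntegrable ν) (hμ : NormIntegrable μ)
    (he : ∀ F ∈ Fe, IsEvenUnder μ F) (ho : ∀ F ∈ Fo, IsOddUnder μ F) (h0 : sconv ν μ = 0)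
    (h : ∀ J ∈ indexFamily E Fe Fo, HasNonzeroTransform ν E J) (hJ : J ⊆ E) {a : Fin n → ℝ}
    (ha : IsWeight E a) : transform μ J a = 0 := by
  by_cases hJF : J ∈ indexFamily E Fe Fo
  · obtain ⟨b, hb, hνb⟩ := h J hJF
    refine (transform_eq_zero_or_of_mul_eq_zero (E := E) (J := J) hν hμ fun a ha => ?_).resolve_left
      (fun h => hνb (h b hb)) a ha
    rw [← transform_sconv hν hμ ha, h0, transform_zero]
  -- A reflection violating the parity condition forces the transform to equal its own negative.
  · have : (∃ F ∈ Fe, ¬ Even (J ∩ F).card) ∨ ∃ F ∈ Fo, ¬ Odd (J ∩ F).card := by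
      by_contra! hcon
      exact hJF ⟨hJ, hcon⟩
    rcases this with ⟨F, hF, hodd⟩ | ⟨F, hF, heven⟩
    · have := neg_one_pow_mul_transform_eq (J := J) hμ ha (F := F) (c := 1)
        (by rw [one_smul]; exact he F hF)
      rw [(Nat.not_even_iff_odd.1 hodd).neg_one_pow] at this
      linarith
    · have := neg_one_pow_mul_transform_eq (J := J) hμ ha (F := F) (c := -1)
        (by rw [neg_smul_smeas, one_smul]; exact ho F hF)
      rw [(Nat.not_odd_iff_even.1 heven).neg_one_pow] at this
      linarith

/-- Verified on transforms: only the pair `(E, J)` contributes, and there the reflection acts by the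
sign `c`. -/
theorem map_reflect_cellWitness (hJ : J ⊆ E) {c : ℝ} (hc : (-1) ^ (J ∩ F).card = c) :
    (cellWitness E J).map (reflect F) = c • cellWitness E J := by
  have hs : ∀ᵐ x ∂(cellWitness E J).variation, x ∈ unitSphere n :=
    (ae_cellWitness E J).mono fun x hx => hx.2
  have hn := NormIntegrable.of_ae_unitSphere hs
  have hr : ∀ᵐ x ∂((cellWitness E J).map (reflect F)).variation, x ∈ unitSphere n := by
    refine ae_map (measurable_reflect F) measurableSet_unitSphere ?_
    filter_upwards [hs] with x hx
    simpa [unitSphere, norm_reflect] using hx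
  have hd : (cellWitness E J).map (reflect F) + (-c) • cellWitness E J = 0 := by
    refine eq_zero_of_transform_eq_zero ?_ fun E' K hK a ha => ?_
    · refine ae_mono VectorMeasure.variation_add_le (ae_add_measure_iff.2 ⟨hr, ?_⟩)
      rw [VectorMeasure.variation_smul]
      exact Measure.ae_smul_measure hs _
    · rw [transform_add (NormIntegrable.of_ae_unitSphere hr) (hn.smul _) ha, transform_smul,
        transform_map_reflect hn ha]
      by_cases h : E' = E ∧ K = J
      · rw [h.2, hc]; ring
      · rw [transform_cellWitness_eq_zero hJ hK ha h]; ring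
  rw [neg_smul_smeas] at hd
  exact eq_of_sub_eq_zero (by rw [sub_eq_add_neg]; exact hd)

theorem exists_mem_symMeasures (hν : NormIntegrable ν) (hE : E.Nonempty)
    (hJ : J ∈ indexFamily E Fe Fo) (h : ¬ HasNonzeroTransform ν E J) :
    ∃ μ ∈ symMeasures (sphereCell E) Fe Fo, sconv ν μ = 0 ∧ μ ≠ 0 := by
  refine ⟨cellWitness E J, ⟨?_, fun F hF => ?_, fun F hF => ?_⟩, ?_, fun h0 => ?_⟩
  · exact (isConcentratedOn_iff_ae (measurableSet_sphereCell E)).2 (ae_cellWitness E J)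
  · rw [IsEvenUnder, map_reflect_cellWitness hJ.1 (hJ.2.1 F hF).neg_one_pow, one_smul]
  · rw [IsOddUnder, map_reflect_cellWitness hJ.1 (hJ.2.2 F hF).neg_one_pow, neg_smul_smeas, one_smul]
  · refine eq_zero_of_transform_eq_zero (ae_sphProj_unitSphere _) fun E' K hK a ha => ?_
    rw [transform_sconv hν (normIntegrable_cellWitness E J) ha]
    by_cases hEK : E' = E ∧ K = J
    · obtain ⟨rfl, rfl⟩ := hEK
      have : transform ν K a = 0 := by
        by_contra hne
        exact h ⟨a, ha, hne⟩
      rw [this, zero_mul]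
    · rw [transform_cellWitness_eq_zero hJ.1 hK ha hEK, mul_zero]
  · exact transform_cellWitness_ne_zero hJ.1 (isWeight_uniform hE) (by rw [h0, transform_zero])

theorem symMeasures_mono {A B : Set (Euc n)} (h : A ⊆ B) :
    symMeasures A Fe Fo ⊆ symMeasures B Fe Fo := fun _ hμ =>
  ⟨fun C hC hCB => hμ.1 C hC (hCB.trans (Set.compl_subset_compl.2 h)), hμ.2⟩

theorem isSphericallyUniversal_sphereCell_iff (hν : NormIntegrable ν) (hE : E.Nonempty) :
    IsSphericallyUniversal ν (symMeasures (sphereCell E) Fe Fo) ↔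
      ∀ J ∈ indexFamily E Fe Fo, HasNonzeroTransform ν E J := by
  refine ⟨fun h J hJ => ?_, fun h μ hμ h0 => ?_⟩
  · by_contra hcon
    obtain ⟨μ, hμ, h0, hne⟩ := exists_mem_symMeasures hν hE hJ hcon
    exact hne (h μ hμ h0)
  · have hμE := (isConcentratedOn_iff_ae (measurableSet_sphereCell E)).1 hμ.1
    exact eq_zero_of_transform_eq_zero_of_sphereCell hE hμE fun J hJ a ha =>
      transform_eq_zero_of_sconv_eq_zero hν (.of_ae_unitSphere (hμE.mono fun x hx => hx.2))
        hμ.2.1 hμ.2.2 h0 h hJ ha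

theorem isSphericallyUniversal_unitSphere_iff (hν : NormIntegrable ν) :
    IsSphericallyUniversal ν (symMeasures (unitSphere n) Fe Fo) ↔
      ∀ E : Finset (Fin n), E ≠ ∅ → ∀ J ∈ indexFamily E Fe Fo, HasNonzeroTransform ν E J := by
  refine ⟨fun h E hE J hJ => ?_, fun h μ hμ h0 => ?_⟩
  · by_contra hcon
    obtain ⟨μ, hμ, h0, hne⟩ :=
      exists_mem_symMeasures hν (Finset.nonempty_iff_ne_empty.2 hE) hJ hcon
    exact hne (h μ (symMeasures_mono Set.inter_subset_right hμ) h0)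
  · have hμS := (isConcentratedOn_iff_ae measurableSet_unitSphere).1 hμ.1
    exact eq_zero_of_transform_eq_zero hμS fun E J hJ a ha =>
      transform_eq_zero_of_sconv_eq_zero hν (.of_ae_unitSphere hμS) hμ.2.1 hμ.2.2 h0
        (h E ha.nonempty.ne_empty) hJ ha

/-- Convolution with `δ_{D,J}` keeps the transforms with signs `J` and kills those with other signs
`K ⊆ E`. The pair `(D, η)` is left free to cover the three forms of the condition in (i), (ii) and
(iii). -/
theorem sconv_deltaMeas_ne_zero_iff {D : Finset (Fin n)} {η : SMeas n} (hη : NormIntegrable η)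
    (hED : E ⊆ D) (hJ : J ⊆ E)
    (hs : ∀ᵐ x ∂(sconv (deltaMeas D J) η).variation, x ∈ sphereCell E)
    (h : ∀ a, IsWeight E a → transform η J a = transform ν J a) :
    sconv (deltaMeas D J) η ≠ 0 ↔ HasNonzeroTransform ν E J := by
  have ht {K : Finset (Fin n)} (hK : K ⊆ E) {a : Fin n → ℝ} (ha : IsWeight E a) :
      transform (sconv (deltaMeas D J) η) K a = (if K = J then 1 else 0) * transform η K a := by
    rw [transform_sconv (normIntegrable_deltaMeas D J) hη ha,
      transform_deltaMeas ha hED (hJ.trans hED) (hK.trans hED)]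
  constructor
  · contrapose!
    intro hcon
    have hz : ∀ K ⊆ E, ∀ a, IsWeight E a → transform (sconv (deltaMeas D J) η) K a = 0 := by
      intro K hK a ha
      rw [ht hK ha]
      split_ifs with hKJ
      · rw [hKJ, h a ha]
        by_contra hne
        exact hcon ⟨a, ha, by simpa using hne⟩
      · rw [zero_mul]
    rcases E.eq_empty_or_nonempty with rfl | hE
    · have : ∀ᵐ x ∂(sconv (deltaMeas D J) η).variation, False := by
        filter_upwards [hs] with x hx using not_mem_cell_empty hx.2 hx.1
      rw [← VectorMeasure.variation_eq_zero]
      simpa using this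
    · exact eq_zero_of_transform_eq_zero_of_sphereCell hE hs hz
  · rintro ⟨a, ha, hne⟩ h0
    have := ht hJ ha
    rw [h0, transform_zero, h a ha] at this
    simp at this
    exact hne this.symm

theorem ae_sphCoordProj (E : Finset (Fin n)) (ν : SMeas n) :
    ∀ᵐ x ∂(sphCoordProj E ν).variation, ∀ i ∉ E, x i = 0 := by
  have hA : MeasurableSet {x : Euc n | ∀ i ∉ E, x i = 0} := by
    have : {x : Euc n | ∀ i ∉ E, x i = 0} = ⋂ i, ⋂ (_ : i ∉ E), {x | x i = 0} := by
      ext; simp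
    rw [this]
    exact .iInter fun i => .iInter fun _ =>
      measurableSet_eq_fun (by fun_prop) measurable_const
  have h1 : ∀ᵐ x ∂(ν.map (coordProj E)).variation, x ∈ {x : Euc n | ∀ i ∉ E, x i = 0} :=
    ae_map (measurable_coordProj E) hA (.of_forall fun x i hi => by simp [coordProj, hi])
  refine ae_sphProj hA ?_
  filter_upwards [h1] with x hx _ i hi
  simp [hx i hi]

theorem transform_sphCoordProj (hν : NormIntegrable ν) (hJ : J ⊆ E) {a : Fin n → ℝ}
    (ha : IsWeight E a) : transform (sphCoordProj E ν) J a = transform ν J a := by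
  rw [sphCoordProj, transform_sphProj (hν.map (measurable_coordProj E) (norm_coordProj_le E)) ha,
    transform_map_coordProj hν ha hJ subset_rfl]

theorem sconv_component_ne_zero_iff (hν : NormIntegrable ν) :
    sconv (deltaMeas Finset.univ J) (component Finset.univ ν) ≠ 0 ↔
      HasNonzeroTransform ν Finset.univ J := by
  refine sconv_deltaMeas_ne_zero_iff (hν.component _) subset_rfl (Finset.subset_univ J) ?_
    fun a ha => transform_component ha (.of_forall fun x F hF => ?_)
  · simpa using ae_sconv_sphereCell (ae_deltaMeas Finset.univ J) (ae_component Finset.univ)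
  · exact absurd (Finset.subset_univ F) hF.2

theorem sconv_component_sphCoordProj_ne_zero_iff (hν : NormIntegrable ν) (hJ : J ⊆ E) :
    sconv (deltaMeas Finset.univ J) (component E (sphCoordProj E ν)) ≠ 0 ↔
      HasNonzeroTransform ν E J := by
  refine sconv_deltaMeas_ne_zero_iff (NormIntegrable.component (.sphProj _) _)
    (Finset.subset_univ E) hJ ?_ fun a ha => ?_
  · simpa using ae_sconv_sphereCell (ae_deltaMeas Finset.univ J) (ae_component E)
  · rw [transform_component ha, transform_sphCoordProj hν hJ ha]
    filter_upwards [ae_sphCoordProj E ν] with x hx F hF hxF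
    obtain ⟨i, hi, hiE⟩ := Finset.not_subset.1 hF.2
    exact (hxF i).2 hi (hx i hiE)

theorem sconv_deltaMeas_ne_zero_iff_of_isOfOrder (hν : NormIntegrable ν)
    (ho : IsOfOrder ν Finset.univ) (hJ : J ⊆ E) :
    sconv (deltaMeas E J) ν ≠ 0 ↔ HasNonzeroTransform ν E J := by
  refine sconv_deltaMeas_ne_zero_iff hν subset_rfl hJ ?_ fun _ _ => rfl
  simpa using ae_sconv_sphereCell (ae_deltaMeas E J) ho.ae_mem_cell

/-- The projected measure sits on `{e_i, -e_i}`, where only `J = ∅` and `J = {i}` matter;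
symmetrising keeps the first transform and kills the second. -/
theorem symmetrise_sphCoordProj_ne_zero_iff (hν : NormIntegrable ν) (i : Fin n) :
    symmetrise (sphCoordProj {i} ν) ≠ 0 ↔ HasNonzeroTransform ν {i} ∅ := by
  set η := sphCoordProj {i} ν with hη
  have hηn : NormIntegrable η := .sphProj _
  have hηi : ∀ᵐ x ∂η.variation, x ∈ sphereCell {i} := by
    filter_upwards [ae_sphCoordProj {i} ν, ae_sphProj_unitSphere _] with x h1 h2
    refine ⟨fun j => ?_, h2⟩
    by_cases hj : j = i
    · simp only [hj, Finset.mem_singleton, iff_true]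
      intro h0
      refine not_mem_cell_empty h2 fun k => ?_
      by_cases hk : k = i
      · simp [hk, h0]
      · simp [h1 k (by simpa using hk)]
    · simp [hj, h1 j (by simpa using hj)]
  have hm (F : Finset (Fin n)) : ∀ᵐ x ∂(η.map (reflect F)).variation, x ∈ sphereCell {i} := by
    refine ae_map (measurable_reflect F) (measurableSet_sphereCell _) ?_
    filter_upwards [hηi] with x hx
    refine ⟨fun j => ?_, by simpa [unitSphere, norm_reflect] using hx.2⟩
    rw [← hx.1 j]
    by_cases hj : j ∈ F <;> simp [reflect, hj]
  have hmn (F : Finset (Fin n)) : NormIntegrable (η.map (reflect F)) :=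
    hηn.map (measurable_reflect F) fun x => (norm_reflect F x).le
  have ht {J : Finset (Fin n)} {a : Fin n → ℝ} (ha : IsWeight {i} a) :
      transform (symmetrise η) J a = 1 / 2 * (1 + (-1) ^ J.card) * transform η J a := by
    rw [symmetrise, transform_smul, transform_add (hmn _) (hmn _) ha,
      transform_map_reflect hηn ha, transform_map_reflect hηn ha]
    simp
    ring
  constructor
  · contrapose!
    intro hcon
    refine eq_zero_of_transform_eq_zero_of_sphereCell (Finset.singleton_nonempty i) ?_
      fun J hJ a ha => ?_
    · rw [symmetrise, VectorMeasure.variation_smul]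
      exact Measure.ae_smul_measure
        (ae_mono VectorMeasure.variation_add_le (ae_add_measure_iff.2 ⟨hm _, hm _⟩)) _
    · rw [ht ha]
      rcases Finset.subset_singleton_iff.1 hJ with rfl | rfl
      · rw [hη, transform_sphCoordProj hν hJ ha]
        by_contra hne
        exact hcon ⟨a, ha, fun h0 => hne (by rw [h0, mul_zero])⟩
      · simp
  · rintro ⟨a, ha, hne⟩ h0
    have := ht (J := ∅) ha
    rw [h0, transform_zero, hη, transform_sphCoordProj hν (Finset.empty_subset _) ha] at this
    simp at this
    exact hne (by linarith)

/-- A weight of `F` is a limit of weights of `E`, and transforms converge by domination by the norm.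
Order `[n]` is essential: `r ↦ |x_i|^r` is continuous at `r = 0` only for `x_i ≠ 0`. -/
theorem HasNonzeroTransform.mono (hν : NormIntegrable ν) (ho : IsOfOrder ν Finset.univ)
    (hFE : F ⊆ E) (h : HasNonzeroTransform ν F J) : HasNonzeroTransform ν E J := by
  obtain ⟨a, ha, hne⟩ := h
  obtain ⟨b, hb⟩ : ∃ b, IsWeight E b := ⟨_, isWeight_uniform (ha.nonempty.mono hFE)⟩
  have hw : ∀ᶠ r : ℝ in 𝓝[>] 0, IsWeight E fun i => a i + r * (b i - a i) := by
    filter_upwards [Ioc_mem_nhdsGT (zero_lt_one' ℝ)] with r hr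
      using ha.segment hFE hb hr.1 hr.2
  have hlim : Tendsto (fun r : ℝ => transform ν J fun i => a i + r * (b i - a i)) (𝓝[>] 0)
      (𝓝 (transform ν J a)) := by
    refine VectorMeasure.tendsto_integral_filter_of_dominated_convergence (fun x => ‖x‖) ?_ ?_ hν ?_
    · exact .of_forall fun r => (measurable_monomial _ _).aestronglyMeasurable
    · filter_upwards [hw] with r hr
      exact .of_forall fun x => abs_monomial_le hr x
    · filter_upwards [ho.ae_mem_cell] with x hx
      have hc : Continuous fun r : ℝ => monomial J (fun i => a i + r * (b i - a i)) x := by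
        refine continuous_const.mul (continuous_finsetProd _ fun i _ => ?_)
        have hxi : |x i| ≠ 0 := abs_ne_zero.2 ((hx i).2 (Finset.mem_univ i))
        exact (Real.continuous_const_rpow hxi).comp (by fun_prop)
      have := (hc.tendsto 0).mono_left (nhdsWithin_le_nhds (s := Set.Ioi 0))
      simpa using this
  obtain ⟨r, hr, hr'⟩ := (hw.and (hlim.eventually_ne hne)).exists
  exact ⟨_, hr, hr'⟩

/-- By monotonicity in `E` the minimal nonempty `E ⊇ J` suffice: `J` itself, or the singletons if `J
= ∅`. The empty set is admissible only if `Fo = ∅`, because its intersections have even cardinality.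
-/
theorem forall_hasNonzeroTransform_iff (hν : NormIntegrable ν) (ho : IsOfOrder ν Finset.univ) :
    (∀ E : Finset (Fin n), E ≠ ∅ → ∀ J ∈ indexFamily E Fe Fo, HasNonzeroTransform ν E J) ↔
      (∀ J ∈ indexFamily Finset.univ Fe Fo, J ≠ ∅ → HasNonzeroTransform ν J J) ∧
        (Fo = ∅ → ∀ i : Fin n, HasNonzeroTransform ν {i} ∅) := by
  constructor
  · refine fun h => ⟨fun J hJ hJne => h J hJne J ⟨subset_rfl, hJ.2⟩, fun hFo i => ?_⟩
    exact h {i} (Finset.singleton_ne_empty i) ∅ ⟨Finset.empty_subset _, by simp, by simp [hFo]⟩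
  · rintro ⟨h1, h2⟩ E hE J hJ
    rcases J.eq_empty_or_nonempty with rfl | hJne
    · have hFo : Fo = ∅ := Set.eq_empty_of_forall_notMem fun F hF => by
        simpa using hJ.2.2 F hF
      obtain ⟨i, hi⟩ := Finset.nonempty_iff_ne_empty.2 hE
      exact (h2 hFo i).mono hν ho (Finset.singleton_subset_iff.2 hi)
    · exact (h1 J ⟨Finset.subset_univ J, hJ.2⟩ hJne.ne_empty).mono hν ho hJ.1

end Universality

end SphericalConvolution

open SphericalConvolution

theorem mainTheorem5 (n : ℕ) (hn : 1 ≤ n) (Fe Fo : Set (Finset (Fin n)))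
    (ν : SMeas n) (hν : IsConcentratedOn ν (unitSphere n)) :
    (IsSphericallyUniversal ν (symMeasures (sphereCell Finset.univ) Fe Fo) ↔
      ∀ J ∈ indexFamily Finset.univ Fe Fo,
        sconv (deltaMeas Finset.univ J) (component Finset.univ ν) ≠ 0) ∧
    (IsSphericallyUniversal ν (symMeasures (unitSphere n) Fe Fo) ↔
      ∀ E : Finset (Fin n), E ≠ ∅ → ∀ J ∈ indexFamily E Fe Fo,
        sconv (deltaMeas Finset.univ J) (component E (sphCoordProj E ν)) ≠ 0) ∧
    (IsOfOrder ν Finset.univ →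
      (IsSphericallyUniversal ν (symMeasures (unitSphere n) Fe Fo) ↔
        ∀ E : Finset (Fin n), E ≠ ∅ → ∀ J ∈ indexFamily E Fe Fo,
          sconv (deltaMeas E J) ν ≠ 0)) ∧
    (IsOfOrder ν Finset.univ →
      (IsSphericallyUniversal ν (symMeasures (unitSphere n) Fe Fo) ↔
        (∀ J ∈ indexFamily Finset.univ Fe Fo, J ≠ ∅ → sconv (deltaMeas J J) ν ≠ 0) ∧
        (Fo = ∅ → ∀ i : Fin n, symmetrise (sphCoordProj {i} ν) ≠ 0))) := by
  have hνn : NormIntegrable ν :=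
    .of_ae_unitSphere ((isConcentratedOn_iff_ae measurableSet_unitSphere).1 hν)
  have huniv : (Finset.univ : Finset (Fin n)).Nonempty := ⟨⟨0, hn⟩, Finset.mem_univ _⟩
  refine ⟨?_, ?_, fun ho => ?_, fun ho => ?_⟩
  · simp only [isSphericallyUniversal_sphereCell_iff hνn huniv, sconv_component_ne_zero_iff hνn]
  · rw [isSphericallyUniversal_unitSphere_iff hνn]
    exact forall₄_congr fun E _ J hJ => (sconv_component_sphCoordProj_ne_zero_iff hνn hJ.1).symm
  · rw [isSphericallyUniversal_unitSphere_iff hνn]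
    exact forall₄_congr fun E _ J hJ =>
      (sconv_deltaMeas_ne_zero_iff_of_isOfOrder hνn ho hJ.1).symm
  · rw [isSphericallyUniversal_unitSphere_iff hνn, forall_hasNonzeroTransform_iff hνn ho]
    simp only [symmetrise_sphCoordProj_ne_zero_iff hνn,
      sconv_deltaMeas_ne_zero_iff_of_isOfOrder hνn ho subset_rfl]
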